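/- **Notation.** For $n\ge 0$ let $\Gamma(n)$ be the semigroup of partial bijections $\gamma$ of $\{1,\dots,n\}$ (bijections between two, possibly empty, subsets $\mathrm{dom}\,\gamma$ and $\mathrm{range}\,\gamma$), where $\gamma\gamma'$ is defined at $x$ iff $\gamma'$ is defined at $x$ and $\gamma$ is defined at $\gamma'(x)$, and then $(\gamma\gamma')(x)=\gamma(\gamma'(x))$. Let $A(n)=\mathbb C[\Gamma(n)]$ be its semigroup algebra. Let $\theta_n:A(n)\to A(n-1)$ be the linear map sending $\gamma\in\Gamma(n)$ to the partial bijection of $\{1,\dots,n-1\}$ which is defined at $x$ iff $\gamma$ is defined at $x$ and $\gamma(x)\ne n$, and then has the value $\gamma(x)$. Fix $m\ge 0$. For $n\ge m$ put $\mathbb N_{mn}=\{m+1,\dots,n\}$, let $\Gamma_m(n)$ be the set of $\gamma\in\Gamma(n)$ fixing each of $1,\dots,m$, and let $A_m(n)$ be the centralizer of $\Gamma_m(n)$ in $A(n)$. For $\gamma\in\Gamma(n)$ let $\deg_m\gamma$ be the number of $x\in\mathbb N_{mn}$ for which $\gamma(x)=x$ does not hold, and $\deg\gamma=\deg_0\gamma$;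 let $F_m^M(A(n))$ be the span of the $\gamma$ with $\deg_m\gamma\le M$. For $a\in A(n)$, $\deg a$ is the largest $\deg\gamma$ over the $\gamma$ occurring in $a$ with nonzero coefficient. The algebra $A_m$ is the projective limit of the filtered algebras $A_m(n)$, $n\ge m$: it consists of the sequences $a=(a_n)_{n\ge m}$ with $a_n\in A_m(n)$, $\theta_n(a_n)=a_{n-1}$ for $n>m$ and $\sup_n\deg a_n<\infty$, with componentwise operations. The $M$-th term $F_m^M(A_m)$ of its $m$-filtration is the subspace of those $a$ with $a_n\in F_m^M(A(n))$ for all $n\ge m$. Let $\Gamma(m,\mathbb Z_+)$ be the set of $m\times m$ matrices with entries in $\{0\}\cup\{1,z,z^2,\dots\}$ having at most one nonzero entry in each row and in each column; $\mathrm{ord}\,\alpha$ is the sum of the exponents $k$ of the nonzero entries $z^k$ of $\alpha$. For $\sigma\in\Gamma(n)$ whose domain and range both contain $\mathbb N_{mn}$, let $\alpha(\sigma)$ be the matrix whose entry $\alpha_{ij}$ ($1\le i,j\le m$) is $z^k$ if there are $p_1,\dots,p_k\in\mathbb N_{mn}$ with $\sigma(j)=p_1$, $\sigma(p_1)=p_2$,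 …, $\sigma(p_k)=i$ (that is, $\sigma(j)=i$ if $k=0$), and $0$ if there is no such $k$; let $P(\sigma)\subseteq\mathbb N_{mn}$ be the set of all the points $p_1,\dots,p_k$ so arising, for all $i,j$. For $\alpha\in\Gamma(m,\mathbb Z_+)$ and $P\subseteq\mathbb N_{mn}$ let $\Gamma(\alpha,P)$ be the set of those $\sigma$ with $\alpha(\sigma)=\alpha$, $P(\sigma)=P$ that fix every point of $\mathbb N_{mn}\setminus P$. For a partition $\mathcal M=(M_1,\dots,M_r)$, possibly empty, of $|\mathcal M|=M_1+\dots+M_r$ and a set $Q\subseteq\mathbb N_{mn}$ with $|Q|=|\mathcal M|$ let $c_Q^{\mathcal M}=\sum(i_1,\dots,i_{M_1})(j_1,\dots,j_{M_2})\cdots(k_1,\dots,k_{M_r})$ be the sum of products of cycles over all orderings $(i_1,\dots,i_{M_1};j_1,\dots,j_{M_2};\dots;k_1,\dots,k_{M_r})$ of $Q$ (with $c^{\emptyset}_{\emptyset}=1$). Let $\varepsilon_i\in\Gamma(n)$ be the identity map of $\{1,\dots,n\}\setminus\{i\}$ and $\varepsilon(I)=\prod_{i\in I}(1-\varepsilon_i)\in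 A(n)$ (the factors commute). Put $$\Delta_n^{\alpha,\mathcal M}=\sum_{P,Q}\ \sum_{\sigma\in\Gamma(\alpha,P)}\varepsilon(P)\,\sigma\,c_Q^{\mathcal M}\,\varepsilon(Q)\,\varepsilon(P)\in A(n),$$ where $P,Q$ run over the disjoint subsets of $\mathbb N_{mn}$ with $|P|=\mathrm{ord}\,\alpha$ and $|Q|=|\mathcal M|$; thus $\Delta_n^{\alpha,\mathcal M}=0$ if $\mathrm{ord}\,\alpha+|\mathcal M|>n-m$. Let $\Delta^{\alpha,\mathcal M}=(\Delta_n^{\alpha,\mathcal M})_{n\ge m}$. **Theorem.** Let $m\ge 0$. The sequences $\Delta^{\alpha,\mathcal M}$ belong to $A_m$, and the elements $\Delta^{\alpha,\mathcal M}$, with $\alpha\in\Gamma(m,\mathbb Z_+)$ and $\mathcal M$ running over all partitions, form a basis of $A_m$ as a complex vector space. Moreover, for every integer $M\ge 0$, the elements $\Delta^{\alpha,\mathcal M}$ with $\mathrm{ord}\,\alpha+|\mathcal M|\le M$ form a basis of the subspace $F_m^M(A_m)$. -/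

import Mathlib

namespace PartialBij

/-- The semigroup `Γ(n)` of partial bijections of an `n`-element set; the points `1, …, n` are
represented by the elements of `Fin n`, so that the point `x` has value `x - 1`.
`γ x = none` means that `γ` is not defined at `x`. -/
abbrev Gam (n : ℕ) : Type := Fin n ≃. Fin n

/-- The product of partial bijections: `γ * δ` is "first `δ`, then `γ`". -/
instance instMonoidGam (n : ℕ) : Monoid (Gam n) where
  mul γ δ := PEquiv.trans δ γ
  one := PEquiv.refl _
  mul_assoc a b c := (PEquiv.trans_assoc c b a).symm
  one_mul a := PEquiv.trans_refl a
  mul_one a := PEquiv.refl_trans a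

noncomputable instance instFintypeGam (n : ℕ) : Fintype (Gam n) :=
  Fintype.ofInjective (fun γ : Gam n => (γ : Fin n → Option (Fin n))) DFunLike.coe_injective

theorem mul_eq_some {n : ℕ} (γ δ : Gam n) (x z : Fin n) :
    (γ * δ) x = some z ↔ ∃ y, δ x = some y ∧ γ y = some z :=
  PEquiv.trans_eq_some δ γ x z

theorem one_apply {n : ℕ} (x : Fin n) : (1 : Gam n) x = some x := rfl

/-- The semigroup algebra `A(n) = ℂ[Γ(n)]`. -/
abbrev Alg (n : ℕ) : Type := MonoidAlgebra ℂ (Gam n)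

/-- The element of `A(n)` given by an element of `Γ(n)`. -/
noncomputable abbrev el {n : ℕ} (γ : Gam n) : Alg n := MonoidAlgebra.of ℂ (Gam n) γ

/-- The inclusion of the first `n` points into `n + 1` points. -/
def incl (n : ℕ) : Fin n ≃. Fin (n + 1) where
  toFun x := some x.castSucc
  invFun y := if h : y.val < n then some ⟨y.val, h⟩ else none
  inv x y := by
    by_cases h : y.val < n
    · simp [h, Fin.ext_iff, eq_comm]
    · simp only [h, dite_false, Fin.ext_iff, Option.some.injEq, reduceCtorEq, false_iff]
      intro hx
      exact h (by rw [← hx]; simp)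

/-- The canonical projection `Γ(n + 1) → Γ(n)`: delete the last row and the last column of the
`(0,1)`-matrix, i.e. `corner γ` is defined at `x` iff `γ x` is defined and is not the last point,
and then it takes the value `γ x`. -/
def corner {n : ℕ} (γ : Gam (n + 1)) : Gam n :=
  ((incl n).trans γ).trans (incl n).symm

/-- The linear extension `θ : A(n + 1) → A(n)` of the canonical projection. -/
noncomputable def theta (n : ℕ) : Alg (n + 1) →ₗ[ℂ] Alg n :=
  MonoidAlgebra.mapDomainLinearMap ℂ ℂ (corner (n := n))

/-- The subsemigroup `Γ_m(n)` of those partial bijections that fix the first `m` points. -/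
def gamFix (m n : ℕ) : Set (Gam n) := {γ | ∀ x : Fin n, x.val < m → γ x = some x}

/-- `A_m(n)`, the centralizer of `Γ_m(n)` in `A(n)`. -/
noncomputable def centr (m n : ℕ) : Subalgebra ℂ (Alg n) :=
  Subalgebra.centralizer ℂ ((fun γ => el γ) '' gamFix m n)

/-- The `m`-degree of `γ`: the number of points `x` outside the first `m` ones such that the
diagonal entry of `γ` at `x` is `0`. For `m = 0` this is the degree of `γ`. -/
def degm (m : ℕ) {n : ℕ} (γ : Gam n) : ℕ :=
  (Finset.univ.filter fun x : Fin n => m ≤ x.val ∧ γ x ≠ some x).card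

/-- The `N`-th term of the `m`-filtration of `A(n)`. -/
noncomputable def filt (m n N : ℕ) : Submodule ℂ (Alg n) :=
  Submodule.span ℂ ((fun γ => el γ) '' {γ : Gam n | degm m γ ≤ N})

/-- The idempotent of `Γ(n)` that is the identity outside the point `x` and undefined at `x`. -/
def eps {n : ℕ} (x : Fin n) : Gam n := PEquiv.ofSet {y | y ≠ x}

theorem eps_eq_some {n : ℕ} (x y z : Fin n) : eps x y = some z ↔ y = z ∧ y ≠ x := by
  unfold eps
  rw [PEquiv.ofSet_eq_some_iff]
  constructor
  · rintro ⟨rfl, h⟩; exact ⟨rfl, h⟩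
  · rintro ⟨rfl, h⟩; exact ⟨rfl, h⟩

theorem eps_comm {n : ℕ} (x y : Fin n) : eps x * eps y = eps y * eps x := by
  refine PEquiv.ext fun u => Option.ext fun w => ?_
  simp only [mul_eq_some, eps_eq_some]
  grind

/-- `ε(I) = ∏_{x ∈ I} (1 - ε_x)`, a product of commuting elements of `A(n)`. -/
noncomputable def epsProd {n : ℕ} (I : Finset (Fin n)) : Alg n :=
  I.noncommProd (fun x => 1 - el (eps x)) (by
    intro x _ y _ _
    have h : Commute (el (eps x)) (el (eps y)) := by
      change _ * _ = _ * _
      rw [← map_mul, ← map_mul, eps_comm]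
    exact ((Commute.one_left _).sub_left ((Commute.one_right _).sub_right h)))

/-! The algebra `A_m`. -/

/-- The degree `degm` is subadditive. -/
theorem degm_mul_le (m : ℕ) {n : ℕ} (γ δ : Gam n) : degm m (γ * δ) ≤ degm m γ + degm m δ := by
  unfold degm
  refine le_trans (Finset.card_le_card ?_) (Finset.card_union_le _ _)
  intro x
  simp only [Finset.mem_filter, Finset.mem_univ, true_and, Finset.mem_union]
  rintro ⟨hx, h⟩
  by_contra hc
  push Not at hc
  exact h ((mul_eq_some _ _ _ _).2 ⟨x, hc.2 hx, hc.1 hx⟩)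

theorem filt_mul_mem {m n M N : ℕ} {a b : Alg n} (ha : a ∈ filt m n M) (hb : b ∈ filt m n N) :
    a * b ∈ filt m n (M + N) := by
  have h := Submodule.mul_mem_mul ha hb
  unfold filt at h ⊢
  rw [Submodule.span_mul_span] at h
  refine Submodule.span_mono ?_ h
  rintro _ ⟨_, ⟨γ, hγ, rfl⟩, _, ⟨δ, hδ, rfl⟩, rfl⟩
  exact ⟨γ * δ, (degm_mul_le m γ δ).trans (Nat.add_le_add hγ hδ), by simp [el, map_mul]⟩

theorem filt_mono {m n M N : ℕ} (h : M ≤ N) : filt m n M ≤ filt m n N := by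
  refine Submodule.span_mono (Set.image_mono ?_)
  intro γ hγ
  exact le_trans hγ h

theorem one_mem_filt (m n N : ℕ) : (1 : Alg n) ∈ filt m n N := by
  refine Submodule.subset_span ⟨1, ?_, map_one _⟩
  simp [degm, one_apply]

theorem incl_eq_some {n : ℕ} (x : Fin n) (y : Fin (n + 1)) :
    incl n x = some y ↔ x.castSucc = y := by
  change some _ = some _ ↔ _
  simp

theorem corner_eq_some {n : ℕ} (γ : Gam (n + 1)) (x y : Fin n) :
    corner γ x = some y ↔ γ x.castSucc = some y.castSucc := by
  unfold corner
  simp [PEquiv.trans_eq_some, PEquiv.eq_some_iff, incl_eq_some]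

theorem corner_one (n : ℕ) : corner (1 : Gam (n + 1)) = 1 := by
  refine PEquiv.ext fun u => Option.ext fun w => ?_
  rw [corner_eq_some]
  simp [one_apply]

theorem theta_el {n : ℕ} (γ : Gam (n + 1)) : theta n (el γ) = el (corner γ) := by
  simp [theta, el, MonoidAlgebra.of_apply]

theorem theta_one (n : ℕ) : theta n 1 = 1 := by
  have := theta_el (1 : Gam (n + 1))
  rw [corner_one] at this
  simpa only [el, map_one] using this

/-- Extension of a partial bijection by "undefined at the last point". -/
def extZero {n : ℕ} (γ : Gam n) : Gam (n + 1) := ((incl n).symm.trans γ).trans (incl n)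

theorem extZero_eq_some {n : ℕ} (γ : Gam n) (x y : Fin (n + 1)) :
    extZero γ x = some y ↔ ∃ u v : Fin n, u.castSucc = x ∧ v.castSucc = y ∧ γ u = some v := by
  unfold extZero
  simp only [PEquiv.trans_eq_some, PEquiv.eq_some_iff, incl_eq_some]
  grind

theorem extZero_injective (n : ℕ) : Function.Injective (extZero (n := n)) := by
  intro γ δ h
  refine PEquiv.ext fun u => Option.ext fun w => ?_
  have h' : extZero γ u.castSucc = some w.castSucc ↔ extZero δ u.castSucc = some w.castSucc := by
    rw [h]
  simpa [extZero_eq_some] using h'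

theorem extZero_mul {n : ℕ} (γ δ : Gam n) : extZero (γ * δ) = extZero γ * extZero δ := by
  refine PEquiv.ext fun u => Option.ext fun w => ?_
  simp only [extZero_eq_some, mul_eq_some]
  constructor
  · rintro ⟨a, b, rfl, rfl, c, h1, h2⟩
    exact ⟨c.castSucc, ⟨a, c, rfl, rfl, h1⟩, c, b, rfl, rfl, h2⟩
  · rintro ⟨c, ⟨a, c', rfl, hc', h1⟩, c'', b, hc'', rfl, h2⟩
    obtain rfl : c' = c'' := Fin.castSucc_injective _ (hc'.trans hc''.symm)
    exact ⟨a, b, rfl, rfl, c', h1, h2⟩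

/-- The `0`-embedding as a multiplicative linear map. -/
noncomputable def extLin (n : ℕ) : Alg n →ₗ[ℂ] Alg (n + 1) :=
  MonoidAlgebra.mapDomainLinearMap ℂ ℂ (extZero (n := n))

theorem extLin_el {n : ℕ} (γ : Gam n) : extLin n (el γ) = el (extZero γ) := by
  simp [extLin, el, MonoidAlgebra.of_apply]

theorem extLin_injective (n : ℕ) : Function.Injective (extLin n) :=
  MonoidAlgebra.mapDomain_injective (extZero_injective n)

theorem extLin_mul {n : ℕ} (a b : Alg n) : extLin n (a * b) = extLin n a * extLin n b := by
  induction a using MonoidAlgebra.induction_on with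
  | of γ =>
    induction b using MonoidAlgebra.induction_on with
    | of δ =>
      rw [← map_mul]
      change extLin n (el _) = extLin n (el _) * extLin n (el _)
      rw [extLin_el, extLin_el, extLin_el, extZero_mul, ← map_mul]
    | add x y hx hy => rw [mul_add, map_add, map_add, mul_add, hx, hy]
    | smul r x hx => rw [mul_smul_comm, map_smul, map_smul, mul_smul_comm, hx]
  | add x y hx hy => rw [add_mul, map_add, map_add, add_mul, hx, hy]
  | smul r x hx => rw [smul_mul_assoc, map_smul, map_smul, smul_mul_assoc, hx]

theorem extLin_theta {n : ℕ} (a : Alg (n + 1)) :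
    extLin n (theta n a) = el (eps (Fin.last n)) * a * el (eps (Fin.last n)) := by
  induction a using MonoidAlgebra.induction_on with
  | of γ =>
    change extLin n (theta n (el γ)) = el _ * el γ * el _
    rw [theta_el, extLin_el, ← map_mul, ← map_mul]
    congr 1
    refine PEquiv.ext fun u => Option.ext fun w => ?_
    simp only [extZero_eq_some, mul_eq_some, corner_eq_some, eps_eq_some]
    constructor
    · rintro ⟨a, b, rfl, rfl, h⟩
      exact ⟨_, ⟨rfl, Fin.castSucc_ne_last a⟩, _, h, rfl, Fin.castSucc_ne_last b⟩
    · rintro ⟨_, ⟨rfl, hu⟩, y, h, rfl, hy⟩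
      refine ⟨u.castPred hu, y.castPred hy, by simp, by simp, by simpa using h⟩
  | add x y hx hy => rw [map_add, map_add, mul_add, add_mul, hx, hy]
  | smul r x hx => rw [map_smul, map_smul, mul_smul_comm, smul_mul_assoc, hx]

/-- `θ` is multiplicative on elements commuting with the idempotent of the last point. -/
theorem theta_mul {n : ℕ} {a b : Alg (n + 1)}
    (ha : el (eps (Fin.last n)) * a = a * el (eps (Fin.last n))) :
    theta n (a * b) = theta n a * theta n b := by
  apply extLin_injective
  have he : (el (eps (Fin.last n)) : Alg (n + 1)) * el (eps (Fin.last n))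
      = el (eps (Fin.last n)) := by
    rw [← map_mul]
    congr 1
    refine PEquiv.ext fun u => Option.ext fun w => ?_
    simp only [mul_eq_some, eps_eq_some]
    grind
  rw [extLin_mul, extLin_theta, extLin_theta, extLin_theta]
  set e : Alg (n + 1) := el (eps (Fin.last n))
  calc e * (a * b) * e = (e * a) * b * e := by simp only [mul_assoc]
    _ = (e * e * a) * b * e := by rw [he]
    _ = e * (e * a) * b * e := by simp only [mul_assoc]
    _ = e * (a * e) * b * e := by rw [ha]
    _ = e * (a * (e * e)) * b * e := by rw [he]
    _ = e * a * e * (e * b * e) := by simp only [mul_assoc]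

theorem eps_comm_centr {m n : ℕ} (hmn : m ≤ n) {a : Alg (n + 1)} (ha : a ∈ centr m (n + 1)) :
    el (eps (Fin.last n)) * a = a * el (eps (Fin.last n)) := by
  refine (Subalgebra.mem_centralizer_iff ℂ).1 ha _ ⟨_, ?_, rfl⟩
  intro x hx
  refine (eps_eq_some _ _ _).2 ⟨rfl, ?_⟩
  rintro rfl
  simp at hx
  omega

/-- The algebra `A_m`: the projective limit, in the category of filtered algebras, of the
algebras `A_m(n)`, `n ≥ m`, along the maps `θ`. Its elements are the sequences
`(a_n)_{n ≥ m}` with `a_n ∈ A_m(n)`, `θ(a_{n+1}) = a_n` and bounded degrees, with componentwise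
operations; the term `a_n` with `n = m + d` is stored at the index `d`. -/
noncomputable def limAlg (m : ℕ) : Subalgebra ℂ (∀ d : ℕ, Alg (m + d)) where
  carrier := {a | (∀ d, a d ∈ centr m (m + d)) ∧ (∀ d, theta (m + d) (a (d + 1)) = a d) ∧
    ∃ N, ∀ d, a d ∈ filt 0 (m + d) N}
  mul_mem' := by
    rintro a b ⟨ha, ha', M, haM⟩ ⟨hb, hb', N, hbN⟩
    refine ⟨fun d => mul_mem (ha d) (hb d), fun d => ?_, M + N,
      fun d => filt_mul_mem (haM d) (hbN d)⟩
    have h : theta (m + d) (a (d + 1) * b (d + 1)) =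
        theta (m + d) (a (d + 1)) * theta (m + d) (b (d + 1)) :=
      theta_mul (eps_comm_centr (Nat.le_add_right m d) (ha (d + 1)))
    rw [ha' d, hb' d] at h
    exact h
  add_mem' := by
    rintro a b ⟨ha, ha', M, haM⟩ ⟨hb, hb', N, hbN⟩
    refine ⟨fun d => add_mem (ha d) (hb d), fun d => ?_, max M N, fun d => add_mem
      (filt_mono (le_max_left M N) (haM d)) (filt_mono (le_max_right M N) (hbN d))⟩
    rw [Pi.add_apply, map_add, ha' d, hb' d, Pi.add_apply]
  algebraMap_mem' := by
    intro r
    refine ⟨fun d => (centr m (m + d)).algebraMap_mem r, fun d => ?_, 0, fun d => ?_⟩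
    · rw [Pi.algebraMap_apply, Pi.algebraMap_apply, Algebra.algebraMap_eq_smul_one,
        Algebra.algebraMap_eq_smul_one, map_smul]
      exact congrArg (r • ·) (theta_one (m + d))
    · rw [Pi.algebraMap_apply, Algebra.algebraMap_eq_smul_one]
      exact Submodule.smul_mem _ _ (one_mem_filt 0 (m + d) 0)

/-- The `N`-th term `F_m^N(A_m)` of the `m`-filtration of `A_m`: the projective limit of the
spaces `F_m^N(A_m(n))`, i.e. the sequences in `A_m` all of whose terms have `m`-degree `≤ N`. -/
noncomputable def limFilt (m N : ℕ) : Submodule ℂ (limAlg m) where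
  carrier := {a | ∀ d, (a : ∀ d : ℕ, Alg (m + d)) d ∈ filt m (m + d) N}
  add_mem' ha hb d := add_mem (ha d) (hb d)
  zero_mem' _ := zero_mem _
  smul_mem' r _ ha d := Submodule.smul_mem _ r (ha d)

/-! The elements `Δ^{α,𝓜}`. -/

/-- The set `Γ(m, ℤ₊)` of `m × m` matrices with entries in `{0} ∪ {1, z, z², …}` such that each row
and each column contains at most one nonzero entry. The entry `0` is represented by `none`, and
the entry `z ^ k` by `some k`. -/
structure GamZ (m : ℕ) where
  entry : Matrix (Fin m) (Fin m) (Option ℕ)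
  row_unique : ∀ i j j', entry i j ≠ none → entry i j' ≠ none → j = j'
  col_unique : ∀ i i' j, entry i j ≠ none → entry i' j ≠ none → i = i'

/-- `ord α`: the sum of the exponents of the nonzero entries. -/
def GamZ.ord {m : ℕ} (α : GamZ m) : ℕ := ∑ i, ∑ j, (α.entry i j).getD 0

/-- The set of all partitions (of all numbers `k = 0, 1, 2, …`). -/
abbrev Ptn : Type := Σ k : ℕ, Nat.Partition k

/-- The size `|𝓜|` of a partition. -/
abbrev Ptn.size (μ : Ptn) : ℕ := μ.1

/-- The parts `M₁ ≥ M₂ ≥ … ≥ M_r` of a partition. -/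
def Ptn.list (μ : Ptn) : List ℕ := μ.2.parts.sort (· ≥ ·)

/-- The points of `{1, …, n}` other than the first `m` ones. -/
def tailPts (m n : ℕ) : Finset (Fin n) := Finset.univ.filter fun x => m ≤ x.val

/-- The points `p 1, …, p k` lie outside the first `m` ones, and
`j = p 0 ↦ p 1 ↦ ⋯ ↦ p k ↦ p (k + 1) = i` under `σ`; here `i` and `j` are among the first `m`
points. (The values of `p` beyond `k + 1` are irrelevant.) -/
def IsPath {m d : ℕ} (σ : Gam (m + d)) (i j : Fin m) (k : ℕ) (p : ℕ → Fin (m + d)) : Prop :=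
  p 0 = Fin.castAdd d j ∧ p (k + 1) = Fin.castAdd d i ∧
    (∀ t, 1 ≤ t → t ≤ k → p t ∈ tailPts m (m + d)) ∧ ∀ t ≤ k, σ (p t) = some (p (t + 1))

open Classical in
/-- The set `Γ(α, P)` of the `σ ∈ Γ(n)`, `n = m + d`, such that
* the domain and the range of `σ` contain all points other than the first `m` ones;
* `α(σ) = α`, i.e. `α_{ij} = z ^ k` precisely when `σ` carries `j` to `i` through `k`
  intermediate points outside the first `m` ones;
* `P(σ) = P`, i.e. `P` is the set of all these intermediate points, for all `i`, `j`;
* `σ` fixes all points that are neither among the first `m` ones nor in `P`. -/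
noncomputable def gamSet {m d : ℕ} (α : GamZ m) (P : Finset (Fin (m + d))) :
    Finset (Gam (m + d)) :=
  Finset.univ.filter fun σ =>
    (∀ x ∈ tailPts m (m + d), (∃ y, σ x = some y) ∧ ∃ y, σ y = some x) ∧
    (∀ i j k, α.entry i j = some k ↔ ∃ p, IsPath σ i j k p) ∧
    (∀ x, x ∈ P ↔ ∃ i j k p, IsPath σ i j k p ∧ ∃ t, 1 ≤ t ∧ t ≤ k ∧ p t = x) ∧
    ∀ x ∈ tailPts m (m + d), x ∉ P → σ x = some x

/-- For a word `w = i₁ … i_{M₁} j₁ … j_{M₂} ⋯` of distinct letters, the product of the cycles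
`(i₁, …, i_{M₁}) (j₁, …, j_{M₂}) ⋯` whose lengths are the parts of the partition. -/
def cycles {n : ℕ} (μ : Ptn) (w : List (Fin n)) : Equiv.Perm (Fin n) :=
  ((μ.list.splitLengths w).map List.formPerm).prod

/-- `c_Q^𝓜`: the sum of the products of cycles over all orderings of the elements of `Q`. -/
noncomputable def cycSum {n : ℕ} (μ : Ptn) (Q : Finset (Fin n)) : Alg n :=
  ((Multiset.lists Q.val).map fun w => el (cycles μ w).toPEquiv).sum

/-- The element `Δ_n^{α,𝓜}`, `n = m + d`: the sum of
`ε(P) σ c_Q^𝓜 ε(Q) ε(P)` over the disjoint subsets `P`, `Q` of `{m + 1, …, n}` with `|P| = ord α`,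
`|Q| = |𝓜|`, and over `σ ∈ Γ(α, P)`. It is `0` (an empty sum) if `ord α + |𝓜| > n - m`. -/
noncomputable def deltaN {m : ℕ} (α : GamZ m) (μ : Ptn) (d : ℕ) : Alg (m + d) :=
  ∑ P ∈ (tailPts m (m + d)).powersetCard α.ord,
    ∑ Q ∈ (tailPts m (m + d) \ P).powersetCard μ.size,
      ∑ σ ∈ gamSet α P, epsProd P * el σ * cycSum μ Q * epsProd Q * epsProd P

end PartialBij

open PartialBij

/-! The argument compares the kernel of the projection from level `n = m + d` to level `n - 1` with
the span of the `Δ` of size `ord α + |𝓜| = d`.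

Kernel. If `a ∈ A_m(n)` is killed by `θ`, then `ε_n a = 0`, because compression by `ε_n` vanishes
and `ε_n` commutes with `a`. Conjugation by permutations fixing the first `m` points gives `ε_x a =
a ε_x = 0` for every tail point `x` (`eps_mul_eq_zero_of_last`). Such an element is determined by
its coefficients at the full partial bijections, those whose domain and range contain the tail
(`eq_zero_of_full`). These coefficients are constant on conjugacy classes under those permutations.

Classes. A full `γ` consists of paths through the tail, starting and ending at the first `m` points,
and of a permutation of the remaining tail points. The paths give `α`, the cycle type gives `𝓜`, and
counting tail points gives `ord α + |𝓜| = d`. Existence, uniqueness and completeness of this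
invariant are `exists_occurs`, `Occurs.unique` and `Labelling.exists_conj`. The factors `ε(P)` and
`ε(Q)` do not affect full coefficients, so on full elements the `Δ` of size `d` is a positive
multiple of the indicator function of its class. It is also annihilated by every tail `ε_x`, hence
these `Δ` span the kernel (`mem_span_deltaN`).

Limit. The `Δ` lie in `A_m`: a summand with `x ∈ P ∪ Q` is killed by `ε_x`, the others commute with
it, and injections fixing the first `m` points permute the summands (`commute_eps_deltaN`,
`commute_ofPerm_deltaN`, `theta_deltaN`). Moreover `Δ_{m+d}` is zero when `d` is less than the size.
Hence an element of `A_m` can be corrected level by level without disturbing lower levels. For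
`m`-degree at most `N` the correction stops after level `m + N`: an element annihilated by all tail
`ε_x` whose degree is less than the number of tail points is zero (`eq_zero_of_mem_filt`). The same
triangularity gives linear independence. -/

namespace PartialBij

/-! Coefficients in `A(n)`. -/

/-- The coefficient of `γ`, as a linear functional. -/
noncomputable def coeffL {n : ℕ} (γ : Gam n) : Alg n →ₗ[ℂ] ℂ where
  toFun a := a.coeff γ
  map_add' _ _ := rfl
  map_smul' _ _ := rfl

theorem coeffL_apply {n : ℕ} (γ : Gam n) (a : Alg n) : coeffL γ a = a.coeff γ := rfl

open Classical in
theorem coeffL_el {n : ℕ} (γ δ : Gam n) : coeffL γ (el δ) = if δ = γ then 1 else 0 := by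
  rw [coeffL_apply, el, MonoidAlgebra.of_apply, MonoidAlgebra.coeff_single, Finsupp.single_apply]

theorem alg_ext {n : ℕ} {a b : Alg n} (h : ∀ γ, coeffL γ a = coeffL γ b) : a = b :=
  MonoidAlgebra.ext (Finsupp.ext h)

theorem eq_sum_el {n : ℕ} (a : Alg n) : a = ∑ γ, coeffL γ a • el γ := by
  classical
  refine alg_ext fun δ => ?_
  simp only [map_sum, map_smul, coeffL_el, smul_eq_mul, mul_ite, mul_one, mul_zero,
    Finset.sum_ite_eq', Finset.mem_univ, if_true]

theorem coeffL_el_mul {n : ℕ} (γ δ : Gam n) (a : Alg n) [DecidableEq (Gam n)] :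
    coeffL δ (el γ * a) = ∑ η, if γ * η = δ then coeffL η a else 0 := by
  classical
  conv_lhs => rw [eq_sum_el a, Finset.mul_sum, map_sum]
  refine Finset.sum_congr rfl fun η _ => ?_
  rw [mul_smul_comm, map_smul, ← map_mul, coeffL_el]
  simp

theorem coeffL_mul_el {n : ℕ} (γ δ : Gam n) (a : Alg n) [DecidableEq (Gam n)] :
    coeffL δ (a * el γ) = ∑ η, if η * γ = δ then coeffL η a else 0 := by
  classical
  conv_lhs => rw [eq_sum_el a, Finset.sum_mul, map_sum]
  refine Finset.sum_congr rfl fun η _ => ?_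
  rw [smul_mul_assoc, map_smul, ← map_mul, coeffL_el]
  simp

theorem mem_span_el {n : ℕ} (S : Set (Gam n)) (a : Alg n) :
    a ∈ Submodule.span ℂ ((fun γ => el γ) '' S) ↔ ∀ γ, coeffL γ a ≠ 0 → γ ∈ S := by
  classical
  constructor
  · intro h γ
    contrapose!
    intro hγ
    induction h using Submodule.span_induction with
    | mem x hx =>
      obtain ⟨δ, hδ, rfl⟩ := hx
      rw [coeffL_el, if_neg]
      rintro rfl
      exact hγ hδ
    | zero => simp
    | add x y _ _ hx hy => simp [hx, hy]
    | smul r x _ hx => simp [hx]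
  · intro h
    rw [eq_sum_el a]
    refine Submodule.sum_mem _ fun γ _ => ?_
    by_cases hγ : coeffL γ a = 0
    · simp [hγ]
    · exact Submodule.smul_mem _ _ (Submodule.subset_span ⟨γ, h γ hγ, rfl⟩)

theorem mem_filt_iff {m n N : ℕ} (a : Alg n) :
    a ∈ filt m n N ↔ ∀ γ, coeffL γ a ≠ 0 → degm m γ ≤ N :=
  mem_span_el _ a

/-! ### Tail points and partial bijections given by graphs. -/

theorem mem_tailPts {m n : ℕ} (x : Fin n) : x ∈ tailPts m n ↔ m ≤ x.val := by
  simp [tailPts]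

theorem gam_ext {n : ℕ} {γ δ : Gam n} (h : ∀ x y, γ x = some y ↔ δ x = some y) : γ = δ :=
  PEquiv.ext fun x => Option.ext (h x)

theorem gam_inj {n : ℕ} (γ : Gam n) {x x' y : Fin n} (h : γ x = some y) (h' : γ x' = some y) :
    x = x' :=
  γ.inj h h'

/-- The partial bijection with a given graph. -/
noncomputable def ofRel {n : ℕ} (R : Fin n → Fin n → Prop)
    (h₁ : ∀ x y y', R x y → R x y' → y = y') (h₂ : ∀ x x' y, R x y → R x' y → x = x') : Gam n := by
  classical
  exact
  { toFun := fun x => if h : ∃ y, R x y then some h.choose else none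
    invFun := fun y => if h : ∃ x, R x y then some h.choose else none
    inv := by
      intro x y
      constructor
      · intro h
        split_ifs at h with hx
        · have hR : R x y := Option.some.inj h ▸ hx.choose_spec
          have hy : ∃ z, R x z := ⟨y, hR⟩
          rw [dif_pos hy]
          exact congrArg some (h₁ _ _ _ hy.choose_spec hR)
      · intro h
        split_ifs at h with hx
        · have hR : R x y := Option.some.inj h ▸ hx.choose_spec
          have hy : ∃ z, R z y := ⟨x, hR⟩
          rw [dif_pos hy]
          exact congrArg some (h₂ _ _ _ hy.choose_spec hR) }

theorem ofRel_eq_some {n : ℕ} (R : Fin n → Fin n → Prop)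
    (h₁ : ∀ x y y', R x y → R x y' → y = y') (h₂ : ∀ x x' y, R x y → R x' y → x = x')
    (x y : Fin n) : ofRel R h₁ h₂ x = some y ↔ R x y := by
  classical
  change (if h : ∃ y, R x y then some h.choose else none) = some y ↔ _
  constructor
  · intro h
    split_ifs at h with hx
    · obtain rfl := Option.some.inj h
      exact hx.choose_spec
  · intro h
    have hy : ∃ z, R x z := ⟨y, h⟩
    rw [dif_pos hy]
    exact congrArg some (h₁ _ _ _ hy.choose_spec h)

/-! Permutations as elements of `Γ(n)`. -/

/-- The inclusion of the symmetric group into `Γ(n)`. -/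
def ofPerm {n : ℕ} (π : Equiv.Perm (Fin n)) : Gam n := π.toPEquiv

theorem ofPerm_eq_some {n : ℕ} (π : Equiv.Perm (Fin n)) (x y : Fin n) :
    ofPerm π x = some y ↔ π x = y := by
  simp [ofPerm, Equiv.toPEquiv_apply]

theorem ofPerm_mul {n : ℕ} (π ρ : Equiv.Perm (Fin n)) : ofPerm (π * ρ) = ofPerm π * ofPerm ρ :=
  gam_ext fun x y => by simp [mul_eq_some, ofPerm_eq_some]

theorem ofPerm_one {n : ℕ} : ofPerm (1 : Equiv.Perm (Fin n)) = 1 :=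
  gam_ext fun x y => by simp [one_apply, ofPerm_eq_some]

theorem ofPerm_mul_inv {n : ℕ} (π : Equiv.Perm (Fin n)) : ofPerm π * ofPerm π⁻¹ = 1 := by
  rw [← ofPerm_mul, mul_inv_cancel, ofPerm_one]

theorem ofPerm_inv_mul {n : ℕ} (π : Equiv.Perm (Fin n)) : ofPerm π⁻¹ * ofPerm π = 1 := by
  rw [← ofPerm_mul, inv_mul_cancel, ofPerm_one]

/-- Compare the coefficients of both sides of `h` at `ofPerm π * γ = δ * ofPerm π`. Since `ofPerm π`
is invertible, exactly one term contributes on each side. -/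
theorem coeffL_conj {n : ℕ} {a : Alg n} (π : Equiv.Perm (Fin n))
    (h : el (ofPerm π) * a = a * el (ofPerm π)) {γ δ : Gam n}
    (hγ : ofPerm π * γ = δ * ofPerm π) : coeffL γ a = coeffL δ a := by
  classical
  have h1 := congrArg (coeffL (ofPerm π * γ)) h
  rw [coeffL_el_mul, hγ, coeffL_mul_el, Finset.sum_eq_single γ, Finset.sum_eq_single δ] at h1
  · simpa [hγ] using h1
  · intro η _ hη
    rw [if_neg]
    intro hc
    apply hη
    have := congrArg (· * ofPerm π⁻¹) hc
    simpa only [mul_assoc, ofPerm_mul_inv, mul_one] using this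
  · simp
  · intro η _ hη
    rw [if_neg]
    intro hc
    apply hη
    rw [← hγ] at hc
    have := congrArg (ofPerm π⁻¹ * ·) hc
    simpa only [← mul_assoc, ofPerm_inv_mul, one_mul] using this
  · simp

/-! Elements annihilated by the idempotents `ε_x`. -/

/-- The coefficient of `el (eps x) * a` at `eps x * δ` is the sum of the coefficients of `a` over
the fibre of `δ` under left multiplication by `eps x`. This drives two inductions in which the other
members of the fibre are already known to have coefficient zero. -/
theorem coeffL_eq_zero_of_eps_mul {n : ℕ} {a : Alg n} {x : Fin n} (h : el (eps x) * a = 0)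
    {δ : Gam n} (hδ : ∀ η, eps x * η = eps x * δ → η ≠ δ → coeffL η a = 0) : coeffL δ a = 0 := by
  classical
  have h1 := coeffL_el_mul (eps x) (eps x * δ) a
  rw [h, map_zero, Finset.sum_eq_single δ] at h1
  · simpa using h1.symm
  · intro η _ hη
    split_ifs with hc
    · exact hδ η hc hη
    · rfl
  · simp

theorem coeffL_eq_zero_of_mul_eps {n : ℕ} {a : Alg n} {x : Fin n} (h : a * el (eps x) = 0)
    {δ : Gam n} (hδ : ∀ η, η * eps x = δ * eps x → η ≠ δ → coeffL η a = 0) : coeffL δ a = 0 := by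
  classical
  have h1 := coeffL_mul_el (eps x) (δ * eps x) a
  rw [h, map_zero, Finset.sum_eq_single δ] at h1
  · simpa using h1.symm
  · intro η _ hη
    split_ifs with hc
    · exact hδ η hc hη
    · rfl
  · simp

theorem eps_mul_eq_some {n : ℕ} (x : Fin n) (γ : Gam n) (y z : Fin n) :
    (eps x * γ) y = some z ↔ γ y = some z ∧ z ≠ x := by
  simp only [mul_eq_some, eps_eq_some]
  grind

theorem mul_eps_eq_some {n : ℕ} (x : Fin n) (γ : Gam n) (y z : Fin n) :
    (γ * eps x) y = some z ↔ γ y = some z ∧ y ≠ x := by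
  simp only [mul_eq_some, eps_eq_some]
  grind

/-! ### Full partial bijections and vanishing criteria. -/

/-- The domain and the range of `γ` contain all points other than the first `m` ones. -/
def Full (m : ℕ) {n : ℕ} (γ : Gam n) : Prop :=
  ∀ x ∈ tailPts m n, (∃ y, γ x = some y) ∧ ∃ y, γ y = some x

theorem card_none_lt {n : ℕ} {γ δ : Gam n} (h : ∀ x y, δ x = some y → γ x = some y)
    (hne : γ ≠ δ) : (Finset.univ.filter fun x => γ x = none).card <
      (Finset.univ.filter fun x => δ x = none).card := by
  apply Finset.card_lt_card
  refine ⟨fun x => ?_, fun hc => hne (gam_ext fun x y => ⟨fun hx => ?_, h x y⟩)⟩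
  · simp only [Finset.mem_filter, Finset.mem_univ, true_and]
    intro hx
    by_contra hd
    obtain ⟨y, hy⟩ := Option.ne_none_iff_exists'.1 hd
    rw [h x y hy] at hx
    cases hx
  · cases hd : δ x with
    | none =>
      have := @hc x (by simp [hd])
      simp [hx] at this
    | some z => rw [← hx, h x z hd]

/-- An element annihilated by all `ε_x` with `x > m` is determined by its coefficients at the full
partial bijections. -/
theorem eq_zero_of_full {m n : ℕ} {a : Alg n} (h₁ : ∀ x ∈ tailPts m n, el (eps x) * a = 0)
    (h₂ : ∀ x ∈ tailPts m n, a * el (eps x) = 0) (h₃ : ∀ γ, Full m γ → coeffL γ a = 0) :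
    a = 0 := by
  refine alg_ext fun δ => ?_
  rw [map_zero]
  induction hk : (Finset.univ.filter fun x => δ x = none).card using Nat.strong_induction_on
    generalizing δ with
  | _ k ih =>
    by_cases hf : Full m δ
    · exact h₃ δ hf
    unfold Full at hf
    push Not at hf
    obtain ⟨x, hx, hx'⟩ := hf
    -- The tail point `x` is missing from the range or from the domain of `δ`. Multiplying by `eps
    -- x` on that side leaves `δ` unchanged, so any other `η` in the fibre properly extends `δ` and
    -- has fewer undefined points.
    by_cases hd : ∃ y, δ x = some y
    · refine coeffL_eq_zero_of_eps_mul (h₁ x hx) fun η hη hne => ?_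
      refine ih _ ?_ η rfl
      rw [← hk]
      refine card_none_lt (fun y z hyz => ?_) hne
      have : (eps x * δ) y = some z := by
        rw [eps_mul_eq_some]
        refine ⟨hyz, ?_⟩
        rintro rfl
        exact hx' hd y hyz
      rw [← hη, eps_mul_eq_some] at this
      exact this.1
    · refine coeffL_eq_zero_of_mul_eps (h₂ x hx) fun η hη hne => ?_
      refine ih _ ?_ η rfl
      rw [← hk]
      refine card_none_lt (fun y z hyz => ?_) hne
      have : (δ * eps x) y = some z := by
        rw [mul_eps_eq_some]
        refine ⟨hyz, ?_⟩
        rintro rfl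
        exact hd ⟨z, hyz⟩
      rw [← hη, mul_eps_eq_some] at this
      exact this.1

theorem card_tailPts (m d : ℕ) : (tailPts m (m + d)).card = d := by
  have : tailPts m (m + d) = Finset.univ.map (Fin.natAddEmb m : Fin d ↪ Fin (m + d)) := by
    ext x
    simp only [mem_tailPts, Finset.mem_map, Finset.mem_univ, true_and, Fin.natAddEmb_apply]
    constructor
    · intro h
      exact ⟨⟨x.val - m, by omega⟩, by ext; simp; omega⟩
    · rintro ⟨y, rfl⟩
      simp
  rw [this, Finset.card_map, Finset.card_univ, Fintype.card_fin]

theorem degm_le (m : ℕ) {d : ℕ} (γ : Gam (m + d)) : degm m γ ≤ d := by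
  conv_rhs => rw [← card_tailPts m d]
  refine Finset.card_le_card fun x hx => ?_
  rw [mem_tailPts]
  exact (Finset.mem_filter.1 hx).2.1

/-- An element of small degree annihilated by all `ε_x` with `x > m` is zero. -/
theorem eq_zero_of_mem_filt {m d N : ℕ} {a : Alg (m + d)}
    (h : ∀ x ∈ tailPts m (m + d), el (eps x) * a = 0) (ha : a ∈ filt m (m + d) N) (hN : N < d) :
    a = 0 := by
  rw [mem_filt_iff] at ha
  refine alg_ext fun γ => ?_
  rw [map_zero]
  -- Downward induction on the degree, which is at most `d`. As `N < d`, a `γ` that occurs in `a`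
  -- must fix some tail point.
  induction hk : d - degm m γ using Nat.strong_induction_on generalizing γ with
  | _ k ih =>
    by_contra hne
    have hdeg := ha γ hne
    obtain ⟨x, hx, hfix⟩ : ∃ x ∈ tailPts m (m + d), γ x = some x := by
      by_contra hc
      push Not at hc
      have : tailPts m (m + d) ⊆ Finset.univ.filter fun x => m ≤ x.val ∧ γ x ≠ some x := by
        intro x hx
        simpa using ⟨(mem_tailPts x).1 hx, hc x hx⟩
      have := Finset.card_le_card this
      rw [card_tailPts] at this
      unfold degm at hdeg
      omega
    -- Another member `η` of the fibre agrees with `γ` apart from the value `x`. As `γ` fixes `x`,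
    -- such an `η` does not, so its degree is strictly larger.
    refine hne (coeffL_eq_zero_of_eps_mul (h x hx) fun η hη hηγ => ?_)
    have key : ∀ y z, z ≠ x → (η y = some z ↔ γ y = some z) := by
      intro y z hz
      have := (eps_mul_eq_some x η y z).symm
      rw [hη, eps_mul_eq_some] at this
      simpa [hz] using this
    have hηx : η x ≠ some x := by
      intro hc
      apply hηγ
      refine gam_ext fun y z => ?_
      by_cases hz : z = x
      · subst hz
        exact ⟨fun hy => by rwa [gam_inj η hy hc], fun hy => by rwa [gam_inj γ hy hfix]⟩
      · exact key y z hz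
    have hlt : degm m γ < degm m η := by
      apply Finset.card_lt_card
      refine ⟨fun y => ?_, fun hc => ?_⟩
      · simp only [Finset.mem_filter, Finset.mem_univ, true_and]
        rintro ⟨hy, hγy⟩
        refine ⟨hy, fun hc => ?_⟩
        by_cases hyx : y = x
        · subst hyx; exact hηx hc
        · exact hγy ((key y y hyx).1 hc)
      · have := @hc x (by simpa using ⟨(mem_tailPts x).1 hx, hηx⟩)
        simp [hfix] at this
    have := degm_le m η
    exact ih _ (by omega) η rfl

/-! The products `ε(I)`. -/

theorem el_mul {n : ℕ} (γ δ : Gam n) : (el (γ * δ) : Alg n) = el γ * el δ := map_mul _ _ _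

theorem el_one {n : ℕ} : (el (1 : Gam n) : Alg n) = 1 := map_one _

theorem eps_mul_self {n : ℕ} (x : Fin n) : eps x * eps x = eps x :=
  gam_ext fun y z => by
    simp only [eps_mul_eq_some, eps_eq_some]
    grind

theorem commute_eps {n : ℕ} (x y : Fin n) : Commute (el (eps x) : Alg n) (el (eps y)) := by
  change _ * _ = _ * _
  rw [← el_mul, ← el_mul, eps_comm]

theorem epsProd_empty {n : ℕ} : epsProd (∅ : Finset (Fin n)) = 1 :=
  Finset.noncommProd_empty _ _

theorem epsProd_insert {n : ℕ} {x : Fin n} {I : Finset (Fin n)} (hx : x ∉ I) :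
    epsProd (insert x I) = (1 - el (eps x)) * epsProd I :=
  Finset.noncommProd_insert_of_notMem _ _ _ _ hx

theorem commute_epsProd {n : ℕ} (x : Fin n) (I : Finset (Fin n)) :
    Commute (el (eps x) : Alg n) (epsProd I) :=
  Finset.noncommProd_commute _ _ _ _ fun y _ => (Commute.one_right _).sub_right (commute_eps x y)

theorem eps_mul_epsProd {n : ℕ} {x : Fin n} {I : Finset (Fin n)} (hx : x ∈ I) :
    el (eps x) * epsProd I = 0 := by
  rw [← Finset.insert_erase hx, epsProd_insert (Finset.notMem_erase x I), ← mul_assoc, mul_sub,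
    mul_one, ← el_mul, eps_mul_self, sub_self, zero_mul]

theorem epsProd_mul_eps {n : ℕ} {x : Fin n} {I : Finset (Fin n)} (hx : x ∈ I) :
    epsProd I * el (eps x) = 0 := by
  rw [← (commute_epsProd x I).eq, eps_mul_epsProd hx]

/-- Everything occurring in `el (eps x) * a` omits `x` from its range and so cannot be full.
Consequently the factors `ε(P)` and `ε(Q)` can be dropped when full coefficients are computed. -/
theorem coeffL_eps_mul {m n : ℕ} {γ : Gam n} (hγ : Full m γ) {x : Fin n} (hx : x ∈ tailPts m n)
    (a : Alg n) : coeffL γ (el (eps x) * a) = 0 := by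
  classical
  rw [coeffL_el_mul]
  refine Finset.sum_eq_zero fun η _ => if_neg ?_
  rintro rfl
  obtain ⟨y, hy⟩ := (hγ x hx).2
  exact ((eps_mul_eq_some x η y x).1 hy).2 rfl

theorem coeffL_mul_eps {m n : ℕ} {γ : Gam n} (hγ : Full m γ) {x : Fin n} (hx : x ∈ tailPts m n)
    (a : Alg n) : coeffL γ (a * el (eps x)) = 0 := by
  classical
  rw [coeffL_mul_el]
  refine Finset.sum_eq_zero fun η _ => if_neg ?_
  rintro rfl
  obtain ⟨y, hy⟩ := (hγ x hx).1
  exact ((mul_eps_eq_some x η x y).1 hy).2 rfl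

theorem coeffL_epsProd_mul {m n : ℕ} {γ : Gam n} (hγ : Full m γ) {I : Finset (Fin n)}
    (hI : I ⊆ tailPts m n) (a : Alg n) : coeffL γ (epsProd I * a) = coeffL γ a := by
  induction I using Finset.induction_on with
  | empty => rw [epsProd_empty, one_mul]
  | insert x I hx ih =>
    rw [epsProd_insert hx, mul_assoc, sub_mul, one_mul, map_sub,
      coeffL_eps_mul hγ (hI (Finset.mem_insert_self x I)), sub_zero,
      ih ((Finset.subset_insert x I).trans hI)]

theorem coeffL_mul_epsProd {m n : ℕ} {γ : Gam n} (hγ : Full m γ) {I : Finset (Fin n)}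
    (hI : I ⊆ tailPts m n) (a : Alg n) : coeffL γ (a * epsProd I) = coeffL γ a := by
  induction I using Finset.induction_on with
  | empty => rw [epsProd_empty, mul_one]
  | insert x I hx ih =>
    have hc : Commute (1 - el (eps x) : Alg n) (epsProd I) :=
      (Commute.one_left _).sub_left (commute_epsProd x I)
    rw [epsProd_insert hx, hc.eq, ← mul_assoc, mul_sub, mul_one, map_sub,
      coeffL_mul_eps hγ (hI (Finset.mem_insert_self x I)), sub_zero,
      ih ((Finset.subset_insert x I).trans hI)]

/-! Products of cycles. -/

theorem formPerm_map {a b : ℕ} (f : Fin a ↪ Fin b) (l : List (Fin a)) (x : Fin a) :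
    (l.map f).formPerm (f x) = f (l.formPerm x) := by
  induction l with
  | nil => simp
  | cons y l ih =>
    cases l with
    | nil => simp
    | cons z l =>
      simp only [List.map_cons, List.formPerm_cons_cons, Equiv.Perm.mul_apply] at ih ⊢
      rw [ih, f.injective.swap_apply]

theorem splitLengths_map {A B : Type*} (f : A → B) (L : List ℕ) (w : List A) :
    L.splitLengths (w.map f) = (L.splitLengths w).map (List.map f) := by
  induction L generalizing w with
  | nil => simp
  | cons k L ih => rw [List.splitLengths_cons, List.splitLengths_cons, ← List.map_take,
      ← List.map_drop, ih, List.map_cons]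

theorem mem_of_mem_splitLengths {A : Type*} {L : List ℕ} {w l : List A}
    (hl : l ∈ L.splitLengths w) {x : A} (hx : x ∈ l) : x ∈ w := by
  induction L generalizing w with
  | nil => simp at hl
  | cons k L ih =>
    rw [List.splitLengths_cons, List.mem_cons] at hl
    rcases hl with rfl | hl
    · exact List.mem_of_mem_take hx
    · exact List.mem_of_mem_drop (ih hl)

theorem prod_formPerm_map {a b : ℕ} (f : Fin a ↪ Fin b) (W : List (List (Fin a))) (x : Fin a) :
    ((W.map (List.map f)).map List.formPerm).prod (f x) = f ((W.map List.formPerm).prod x) := by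
  induction W with
  | nil => simp
  | cons w W ih =>
    simp only [List.map_cons, List.prod_cons, Equiv.Perm.mul_apply]
    rw [ih, formPerm_map]

theorem prod_formPerm_apply_of_notMem {n : ℕ} (W : List (List (Fin n))) (x : Fin n)
    (hx : ∀ w ∈ W, x ∉ w) : (W.map List.formPerm).prod x = x := by
  induction W with
  | nil => simp
  | cons w W ih =>
    simp only [List.map_cons, List.prod_cons, Equiv.Perm.mul_apply]
    rw [ih fun v hv => hx v (List.mem_cons_of_mem _ hv),
      List.formPerm_apply_of_notMem (hx w List.mem_cons_self)]

theorem cycles_map {a b : ℕ} (f : Fin a ↪ Fin b) (μ : Ptn) (w : List (Fin a)) (x : Fin a) :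
    cycles μ (w.map f) (f x) = f (cycles μ w x) := by
  unfold cycles
  rw [splitLengths_map, prod_formPerm_map]

theorem cycles_apply_of_notMem {n : ℕ} (μ : Ptn) {w : List (Fin n)} {x : Fin n} (hx : x ∉ w) :
    cycles μ w x = x :=
  prod_formPerm_apply_of_notMem _ _ fun _ hv hxv => hx (mem_of_mem_splitLengths hv hxv)

theorem mem_lists_val {n : ℕ} {Q : Finset (Fin n)} {w : List (Fin n)}
    (hw : w ∈ Multiset.lists Q.val) : w.Nodup ∧ (∀ x, x ∈ w ↔ x ∈ Q) ∧ w.length = Q.card := by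
  rw [Multiset.mem_lists_iff] at hw
  have hw : Q.val = (w : Multiset (Fin n)) := hw
  refine ⟨?_, fun x => ?_, ?_⟩
  · rw [← Multiset.coe_nodup, ← hw]
    exact Q.nodup
  · rw [← Finset.mem_val, hw, Multiset.mem_coe]
  · rw [← Finset.card_val, hw, Multiset.coe_card]

theorem lists_map {a b : ℕ} (f : Fin a ↪ Fin b) (Q : Finset (Fin a)) :
    Multiset.lists (Q.map f).val = (Multiset.lists Q.val).map (List.map f) := by
  rw [Finset.map_val]
  obtain ⟨l, hl⟩ := Quot.exists_rep Q.val
  rw [← hl]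
  change Multiset.lists (((l.map f : List (Fin b)) : Multiset (Fin b))) =
    (Multiset.lists (l : Multiset (Fin a))).map (List.map f)
  rw [Multiset.lists_coe, Multiset.lists_coe, Multiset.map_coe, List.map_permutations]

/-! Functoriality of `Γ(n)` with respect to injections. -/

/-- The relation defining `push`. -/
def PushRel {a b : ℕ} (f : Fin a ↪ Fin b) (σ : Gam a) (x y : Fin b) : Prop :=
  (∃ x' y', f x' = x ∧ f y' = y ∧ σ x' = some y') ∨ (x = y ∧ x ∉ Set.range f)

/-- Transport of a partial bijection along an injection `f`, extended by the identity outside of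
the image of `f`. -/
noncomputable def push {a b : ℕ} (f : Fin a ↪ Fin b) (σ : Gam a) : Gam b :=
  ofRel (PushRel f σ)
    (by
      rintro x y y' (⟨x₁, y₁, rfl, rfl, h⟩ | ⟨rfl, h⟩) (⟨x₂, y₂, hx, rfl, h'⟩ | ⟨rfl, h'⟩)
      · obtain rfl := f.injective hx
        rw [h] at h'
        rw [Option.some.inj h']
      · exact absurd ⟨x₁, rfl⟩ h'
      · exact absurd ⟨x₂, hx⟩ h
      · rfl)
    (by
      rintro x x' y (⟨x₁, y₁, rfl, rfl, h⟩ | ⟨rfl, h⟩) (⟨x₂, y₂, rfl, hy, h'⟩ | ⟨rfl, h'⟩)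
      · obtain rfl := f.injective hy
        rw [gam_inj σ h h']
      · exact absurd ⟨y₁, rfl⟩ h'
      · exact absurd ⟨y₂, hy⟩ h
      · rfl)

theorem push_eq_some {a b : ℕ} (f : Fin a ↪ Fin b) (σ : Gam a) (x y : Fin b) :
    push f σ x = some y ↔
      (∃ x' y', f x' = x ∧ f y' = y ∧ σ x' = some y') ∨ (x = y ∧ x ∉ Set.range f) :=
  ofRel_eq_some _ _ _ _ _

theorem push_apply {a b : ℕ} (f : Fin a ↪ Fin b) (σ : Gam a) (x : Fin a) (y : Fin b) :
    push f σ (f x) = some y ↔ ∃ y', f y' = y ∧ σ x = some y' := by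
  rw [push_eq_some]
  constructor
  · rintro (⟨x', y', hx, rfl, h⟩ | ⟨-, h⟩)
    · obtain rfl := f.injective hx
      exact ⟨y', rfl, h⟩
    · exact absurd ⟨x, rfl⟩ h
  · rintro ⟨y', rfl, h⟩
    exact Or.inl ⟨x, y', rfl, rfl, h⟩

theorem push_apply_apply {a b : ℕ} (f : Fin a ↪ Fin b) (σ : Gam a) (x y : Fin a) :
    push f σ (f x) = some (f y) ↔ σ x = some y := by
  rw [push_apply]
  simp

theorem push_apply_of_notMem {a b : ℕ} (f : Fin a ↪ Fin b) (σ : Gam a) {x : Fin b}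
    (hx : x ∉ Set.range f) : push f σ x = some x :=
  (push_eq_some _ _ _ _).2 (Or.inr ⟨rfl, hx⟩)

theorem push_injective {a b : ℕ} (f : Fin a ↪ Fin b) : Function.Injective (push f) :=
  fun σ τ h => gam_ext fun x y => by rw [← push_apply_apply f, h, push_apply_apply]

theorem push_one {a b : ℕ} (f : Fin a ↪ Fin b) : push f 1 = 1 :=
  gam_ext fun x y => by
    rw [push_eq_some, one_apply]
    constructor
    · rintro (⟨x', y', rfl, rfl, h⟩ | ⟨rfl, h⟩)
      · rw [one_apply] at h
        rw [Option.some.inj h]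
      · rfl
    · intro h
      obtain rfl := Option.some.inj h
      by_cases hx : x ∈ Set.range f
      · obtain ⟨x', rfl⟩ := hx
        exact Or.inl ⟨x', x', rfl, rfl, rfl⟩
      · exact Or.inr ⟨rfl, hx⟩

theorem push_mul {a b : ℕ} (f : Fin a ↪ Fin b) (σ τ : Gam a) :
    push f (σ * τ) = push f σ * push f τ :=
  gam_ext fun x y => by
    rw [mul_eq_some]
    by_cases hx : x ∈ Set.range f
    · obtain ⟨x, rfl⟩ := hx
      simp only [push_apply, mul_eq_some]
      constructor
      · rintro ⟨z, rfl, u, h, h'⟩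
        exact ⟨f u, ⟨u, rfl, h⟩, (push_apply_apply f σ u z).2 h'⟩
      · rintro ⟨_, ⟨u, rfl, h⟩, h'⟩
        obtain ⟨z, rfl, h''⟩ := (push_apply f σ u y).1 h'
        exact ⟨z, rfl, u, h, h''⟩
    · rw [push_apply_of_notMem f _ hx, push_apply_of_notMem f _ hx]
      constructor
      · intro h
        exact ⟨x, rfl, by rw [← h, push_apply_of_notMem f _ hx]⟩
      · rintro ⟨u, hu, h⟩
        obtain rfl := Option.some.inj hu
        rwa [push_apply_of_notMem f _ hx] at h

/-- `push` as a homomorphism of semigroups. -/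
noncomputable def pushHom {a b : ℕ} (f : Fin a ↪ Fin b) : Gam a →* Gam b where
  toFun := push f
  map_one' := push_one f
  map_mul' := push_mul f

/-- `push` as a homomorphism of algebras. -/
noncomputable def pushAlg {a b : ℕ} (f : Fin a ↪ Fin b) : Alg a →ₐ[ℂ] Alg b :=
  MonoidAlgebra.lift ℂ (Alg b) (Gam a) ((MonoidAlgebra.of ℂ (Gam b)).comp (pushHom f))

theorem pushAlg_el {a b : ℕ} (f : Fin a ↪ Fin b) (σ : Gam a) :
    pushAlg f (el σ) = el (push f σ) :=
  MonoidAlgebra.lift_of _ _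

theorem push_eps {a b : ℕ} (f : Fin a ↪ Fin b) (x : Fin a) : push f (eps x) = eps (f x) :=
  gam_ext fun y z => by
    rw [push_eq_some]
    simp only [eps_eq_some]
    constructor
    · rintro (⟨x', y', rfl, rfl, rfl, h⟩ | ⟨rfl, h⟩)
      · exact ⟨rfl, fun hc => h (f.injective hc)⟩
      · exact ⟨rfl, fun hc => h ⟨x, hc.symm⟩⟩
    · rintro ⟨rfl, h⟩
      by_cases hy : y ∈ Set.range f
      · obtain ⟨y, rfl⟩ := hy
        exact Or.inl ⟨y, y, rfl, rfl, rfl, fun hc => h (congrArg f hc)⟩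
      · exact Or.inr ⟨rfl, hy⟩

theorem pushAlg_epsProd {a b : ℕ} (f : Fin a ↪ Fin b) (I : Finset (Fin a)) :
    pushAlg f (epsProd I) = epsProd (I.map f) := by
  induction I using Finset.induction_on with
  | empty => rw [Finset.map_empty, epsProd_empty, epsProd_empty, map_one]
  | insert x I hx ih =>
    rw [Finset.map_insert, epsProd_insert hx, epsProd_insert (by simpa using hx), map_mul, ih,
      map_sub, map_one, pushAlg_el, push_eps]

theorem push_cycles {a b : ℕ} (f : Fin a ↪ Fin b) (μ : Ptn) (w : List (Fin a)) :
    push f (ofPerm (cycles μ w)) = ofPerm (cycles μ (w.map f)) :=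
  gam_ext fun x y => by
    rw [ofPerm_eq_some]
    by_cases hx : x ∈ Set.range f
    · obtain ⟨x, rfl⟩ := hx
      rw [push_apply, cycles_map]
      simp only [ofPerm_eq_some]
      constructor
      · rintro ⟨_, rfl, rfl⟩
        rfl
      · rintro rfl
        exact ⟨_, rfl, rfl⟩
    · rw [push_apply_of_notMem f _ hx, cycles_apply_of_notMem]
      · exact Option.some_inj
      · rw [List.mem_map]
        rintro ⟨z, -, rfl⟩
        exact hx ⟨z, rfl⟩

theorem cycSum_eq {n : ℕ} (μ : Ptn) (Q : Finset (Fin n)) :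
    cycSum μ Q = ((Multiset.lists Q.val).map fun w => (el (ofPerm (cycles μ w)) : Alg n)).sum :=
  rfl

theorem pushAlg_cycSum {a b : ℕ} (f : Fin a ↪ Fin b) (μ : Ptn) (Q : Finset (Fin a)) :
    pushAlg f (cycSum μ Q) = cycSum μ (Q.map f) := by
  rw [cycSum_eq, cycSum_eq, map_multiset_sum, lists_map, Multiset.map_map, Multiset.map_map]
  refine congrArg _ (Multiset.map_congr rfl fun w _ => ?_)
  simp only [Function.comp_apply]
  rw [pushAlg_el, push_cycles]

/-! Terms of `Δ`. -/

/-- The contribution of `P`, `Q` to `Δ`. -/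
noncomputable def deltaTerm {m d : ℕ} (α : GamZ m) (μ : Ptn) (P Q : Finset (Fin (m + d))) :
    Alg (m + d) :=
  ∑ σ ∈ gamSet α P, epsProd P * el σ * cycSum μ Q * epsProd Q * epsProd P

theorem deltaN_eq {m : ℕ} (α : GamZ m) (μ : Ptn) (d : ℕ) : deltaN α μ d =
    ∑ P ∈ (tailPts m (m + d)).powersetCard α.ord,
      ∑ Q ∈ (tailPts m (m + d) \ P).powersetCard μ.size, deltaTerm α μ P Q := rfl

/-- Linear properties of `Δ` (vanishing, commutation, a degree bound) are phrased as membership in a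
submodule, which reduces them to single products with one `σ` and one word `w`. -/
theorem deltaTerm_mem {m d : ℕ} {α : GamZ m} {μ : Ptn} {P Q : Finset (Fin (m + d))}
    (V : Submodule ℂ (Alg (m + d)))
    (h : ∀ σ ∈ gamSet α P, ∀ w ∈ Multiset.lists Q.val,
      epsProd P * el σ * el (ofPerm (cycles μ w)) * epsProd Q * epsProd P ∈ V) :
    deltaTerm α μ P Q ∈ V := by
  refine Submodule.sum_mem _ fun σ hσ => ?_
  rw [cycSum_eq, ← Multiset.sum_map_mul_left, ← Multiset.sum_map_mul_right,
    ← Multiset.sum_map_mul_right]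
  refine multiset_sum_mem _ fun a ha => ?_
  obtain ⟨w, hw, rfl⟩ := Multiset.mem_map.1 ha
  exact h σ hσ w hw

theorem deltaN_mem {m d : ℕ} {α : GamZ m} {μ : Ptn} (V : Submodule ℂ (Alg (m + d)))
    (h : ∀ P Q, P ⊆ tailPts m (m + d) → Q ⊆ tailPts m (m + d) → Disjoint P Q →
      P.card = α.ord → Q.card = μ.size → deltaTerm α μ P Q ∈ V) : deltaN α μ d ∈ V := by
  rw [deltaN_eq]
  refine Submodule.sum_mem _ fun P hP => Submodule.sum_mem _ fun Q hQ => ?_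
  rw [Finset.mem_powersetCard] at hP hQ
  exact h P Q hP.1 (hQ.1.trans Finset.sdiff_subset)
    (Finset.disjoint_of_subset_right hQ.1 Finset.disjoint_sdiff) hP.2 hQ.2

/-! Paths and functoriality. -/

theorem isPath_congr {m d : ℕ} {σ : Gam (m + d)} {i j : Fin m} {k : ℕ} {p q : ℕ → Fin (m + d)}
    (h : ∀ t ≤ k + 1, p t = q t) (hp : IsPath σ i j k p) : IsPath σ i j k q := by
  obtain ⟨h0, h1, h2, h3⟩ := hp
  refine ⟨by rw [← h 0 (by omega), h0], by rw [← h (k + 1) le_rfl, h1], fun t ht ht' => ?_,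
    fun t ht => ?_⟩
  · rw [← h t (by omega)]
    exact h2 t ht ht'
  · rw [← h t (by omega), ← h (t + 1) (by omega)]
    exact h3 t ht

/-- An injection of `{1, …, m + s}` into `{1, …, m + d}` that fixes the first `m` points. -/
structure FixHead {m s d : ℕ} (f : Fin (m + s) ↪ Fin (m + d)) : Prop where
  head : ∀ j : Fin m, f (Fin.castAdd s j) = Fin.castAdd d j
  tail : ∀ x, f x ∈ tailPts m (m + d) ↔ x ∈ tailPts m (m + s)

theorem FixHead.mem_tail {m s d : ℕ} {f : Fin (m + s) ↪ Fin (m + d)} (hf : FixHead f)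
    {x : Fin (m + d)} (hx : x ∉ Set.range f) : x ∈ tailPts m (m + d) := by
  rw [mem_tailPts]
  by_contra hc
  exact hx ⟨Fin.castAdd s ⟨x.val, by omega⟩, by rw [hf.head]; rfl⟩

theorem FixHead.isPath_push {m s d : ℕ} {f : Fin (m + s) ↪ Fin (m + d)} (hf : FixHead f)
    {σ : Gam (m + s)} {i j : Fin m} {k : ℕ} {p : ℕ → Fin (m + s)} :
    IsPath (push f σ) i j k (fun t => f (p t)) ↔ IsPath σ i j k p := by
  unfold IsPath
  simp only [← hf.head, f.injective.eq_iff, hf.tail, push_apply_apply]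

/-- The path starts in the range of `f`, and `push f σ` maps points of the range into the range, so
all its relevant points lift. -/
theorem FixHead.isPath_lift {m s d : ℕ} {f : Fin (m + s) ↪ Fin (m + d)} (hf : FixHead f)
    {σ : Gam (m + s)} {i j : Fin m} {k : ℕ} {p : ℕ → Fin (m + d)}
    (hp : IsPath (push f σ) i j k p) :
    ∃ q, IsPath σ i j k q ∧ ∀ t ≤ k + 1, f (q t) = p t := by
  have hr : ∀ t ≤ k + 1, ∃ x, f x = p t := by
    intro t
    induction t with
    | zero => exact fun _ => ⟨_, (hf.head j).trans hp.1.symm⟩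
    | succ t ih =>
      intro ht
      obtain ⟨x, hx⟩ := ih (by omega)
      have h := hp.2.2.2 t (by omega)
      rw [← hx, push_apply] at h
      obtain ⟨y, hy, -⟩ := h
      exact ⟨y, hy⟩
  have hr' : ∀ t, ∃ x, t ≤ k + 1 → f x = p t := fun t => by
    by_cases ht : t ≤ k + 1
    · obtain ⟨x, hx⟩ := hr t ht
      exact ⟨x, fun _ => hx⟩
    · exact ⟨Fin.castAdd s j, fun h => absurd h ht⟩
  choose q hq using hr'
  exact ⟨q, hf.isPath_push.1 (isPath_congr (fun t ht => (hq t ht).symm) hp), hq⟩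

theorem mem_gamSet {m d : ℕ} {α : GamZ m} {P : Finset (Fin (m + d))} {σ : Gam (m + d)} :
    σ ∈ gamSet α P ↔ Full m σ ∧
    (∀ i j k, α.entry i j = some k ↔ ∃ p, IsPath σ i j k p) ∧
    (∀ x, x ∈ P ↔ ∃ i j k p, IsPath σ i j k p ∧ ∃ t, 1 ≤ t ∧ t ≤ k ∧ p t = x) ∧
    ∀ x ∈ tailPts m (m + d), x ∉ P → σ x = some x := by
  simp [gamSet, Full]

theorem FixHead.full_push {m s d : ℕ} {f : Fin (m + s) ↪ Fin (m + d)} (hf : FixHead f)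
    {σ : Gam (m + s)} : Full m (push f σ) ↔ Full m σ := by
  constructor
  · intro h x hx
    obtain ⟨⟨y, hy⟩, ⟨z, hz⟩⟩ := h (f x) ((hf.tail x).2 hx)
    obtain ⟨y', -, hy'⟩ := (push_apply f σ x y).1 hy
    refine ⟨⟨y', hy'⟩, ?_⟩
    rcases (push_eq_some f σ z (f x)).1 hz with ⟨z', x', rfl, hx', hzx⟩ | ⟨hzx, h⟩
    · rw [f.injective hx'] at hzx
      exact ⟨z', hzx⟩
    · exact absurd ⟨x, hzx.symm⟩ h
  · intro h x hx
    by_cases hx' : x ∈ Set.range f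
    · obtain ⟨x, rfl⟩ := hx'
      obtain ⟨⟨y, hy⟩, ⟨z, hz⟩⟩ := h x ((hf.tail x).1 hx)
      exact ⟨⟨f y, (push_apply_apply f σ x y).2 hy⟩, ⟨f z, (push_apply_apply f σ z x).2 hz⟩⟩
    · exact ⟨⟨x, push_apply_of_notMem f σ hx'⟩, ⟨x, push_apply_of_notMem f σ hx'⟩⟩

theorem FixHead.push_mem_gamSet {m s d : ℕ} {f : Fin (m + s) ↪ Fin (m + d)} (hf : FixHead f)
    {α : GamZ m} {P : Finset (Fin (m + s))} {σ : Gam (m + s)} :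
    push f σ ∈ gamSet α (P.map f) ↔ σ ∈ gamSet α P := by
  rw [mem_gamSet, mem_gamSet]
  refine and_congr hf.full_push (and_congr ?_ (and_congr ?_ ?_))
  · refine forall_congr' fun i => forall_congr' fun j => forall_congr' fun k => iff_congr Iff.rfl ?_
    exact ⟨fun ⟨p, hp⟩ => (hf.isPath_lift hp).imp fun q hq => hq.1,
      fun ⟨p, hp⟩ => ⟨_, hf.isPath_push.2 hp⟩⟩
  · have key : ∀ x, (∃ i j k p, IsPath (push f σ) i j k p ∧ ∃ t, 1 ≤ t ∧ t ≤ k ∧ p t = x) ↔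
        ∃ y, f y = x ∧ ∃ i j k p, IsPath σ i j k p ∧ ∃ t, 1 ≤ t ∧ t ≤ k ∧ p t = y := by
      intro x
      constructor
      · rintro ⟨i, j, k, p, hp, t, ht, ht', rfl⟩
        obtain ⟨q, hq, hqp⟩ := hf.isPath_lift hp
        exact ⟨q t, hqp t (by omega), i, j, k, q, hq, t, ht, ht', rfl⟩
      · rintro ⟨_, rfl, i, j, k, p, hp, t, ht, ht', rfl⟩
        exact ⟨i, j, k, _, hf.isPath_push.2 hp, t, ht, ht', rfl⟩
    simp only [key, Finset.mem_map]
    constructor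
    · intro h x
      rw [show x ∈ P ↔ ∃ a ∈ P, f a = f x from
        ⟨fun hx => ⟨x, hx, rfl⟩, fun ⟨a, ha, e⟩ => f.injective e ▸ ha⟩, h (f x)]
      exact ⟨fun ⟨y, e, hy⟩ => f.injective e ▸ hy, fun hy => ⟨x, rfl, hy⟩⟩
    · intro h x
      simp only [h]
      tauto
  · constructor
    · intro h x hx hxP
      exact (push_apply_apply f σ x x).1 (h (f x) ((hf.tail x).2 hx) (by simpa using hxP))
    · intro h x hx hxP
      by_cases hx' : x ∈ Set.range f
      · obtain ⟨x, rfl⟩ := hx'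
        exact (push_apply_apply f σ x x).2 (h x ((hf.tail x).1 hx) (by simpa using hxP))
      · exact push_apply_of_notMem f σ hx'

/-- By injectivity, `σ` cannot send a point of the range of `f` to a point outside, since such a
point is already the image of itself. So the restriction of `σ` to the range can be pulled back. -/
theorem exists_push_eq {a b : ℕ} (f : Fin a ↪ Fin b) {σ : Gam b}
    (h : ∀ x ∉ Set.range f, σ x = some x) : ∃ τ, push f τ = σ := by
  refine ⟨ofRel (fun x y => σ (f x) = some (f y)) (fun x y y' hy hy' => ?_)
    (fun x x' y hx hx' => f.injective (gam_inj σ hx hx')), gam_ext fun x y => ?_⟩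
  · rw [hy] at hy'
    exact f.injective (Option.some.inj hy')
  · by_cases hx : x ∈ Set.range f
    · obtain ⟨x, rfl⟩ := hx
      simp only [push_apply, ofRel_eq_some]
      constructor
      · rintro ⟨_, rfl, h⟩
        exact h
      · intro hy
        by_cases hyf : y ∈ Set.range f
        · obtain ⟨y, rfl⟩ := hyf
          exact ⟨y, rfl, hy⟩
        · exact absurd ⟨x, gam_inj σ hy (h y hyf)⟩ hyf
    · rw [push_apply_of_notMem f _ hx, h x hx]

theorem FixHead.gamSet_map {m s d : ℕ} {f : Fin (m + s) ↪ Fin (m + d)} (hf : FixHead f)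
    (α : GamZ m) (P : Finset (Fin (m + s))) :
    gamSet α (P.map f) = (gamSet α P).map ⟨push f, push_injective f⟩ := by
  ext σ
  rw [Finset.mem_map]
  constructor
  · intro hσ
    obtain ⟨τ, rfl⟩ := exists_push_eq f (σ := σ) fun x hx =>
      (mem_gamSet.1 hσ).2.2.2 x (hf.mem_tail hx) (by
        rw [Finset.mem_map]
        rintro ⟨y, -, rfl⟩
        exact hx ⟨y, rfl⟩)
    exact ⟨τ, hf.push_mem_gamSet.1 hσ, rfl⟩
  · rintro ⟨τ, hτ, rfl⟩
    exact hf.push_mem_gamSet.2 hτ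

theorem FixHead.pushAlg_deltaTerm {m s d : ℕ} {f : Fin (m + s) ↪ Fin (m + d)} (hf : FixHead f)
    (α : GamZ m) (μ : Ptn) (P Q : Finset (Fin (m + s))) :
    pushAlg f (deltaTerm α μ P Q) = deltaTerm α μ (P.map f) (Q.map f) := by
  unfold deltaTerm
  rw [hf.gamSet_map, Finset.sum_map, map_sum]
  refine Finset.sum_congr rfl fun σ _ => ?_
  simp only [map_mul, pushAlg_el, pushAlg_epsProd, pushAlg_cycSum, Function.Embedding.coeFn_mk]

/-- This has two uses: with `f` a permutation it gives commutation with permutations, and with `f`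
the inclusion of one more point it gives compatibility with `θ`. -/
theorem FixHead.pushAlg_deltaN {m s d : ℕ} {f : Fin (m + s) ↪ Fin (m + d)} (hf : FixHead f)
    (α : GamZ m) (μ : Ptn) : pushAlg f (deltaN α μ s) =
    ∑ P ∈ ((tailPts m (m + s)).map f).powersetCard α.ord,
      ∑ Q ∈ ((tailPts m (m + s)).map f \ P).powersetCard μ.size, deltaTerm α μ P Q := by
  rw [deltaN_eq, Finset.powersetCard_map, Finset.sum_map, map_sum]
  refine Finset.sum_congr rfl fun P _ => ?_
  change _ = ∑ Q ∈ ((tailPts m (m + s)).map f \ P.map f).powersetCard μ.size,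
    deltaTerm α μ (P.map f) Q
  rw [← Finset.map_sdiff, Finset.powersetCard_map, Finset.sum_map,
    map_sum]
  refine Finset.sum_congr rfl fun Q _ => ?_
  rw [hf.pushAlg_deltaTerm]
  rfl

/-! The elements `Δ` belong to the centralizer. -/

theorem eps_comm_of_fix {n : ℕ} {σ : Gam n} {x : Fin n} (h : σ x = some x) :
    eps x * σ = σ * eps x :=
  gam_ext fun y z => by
    rw [eps_mul_eq_some, mul_eps_eq_some]
    refine and_congr_right fun hy => not_congr ⟨?_, ?_⟩
    · rintro rfl
      exact gam_inj σ hy h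
    · rintro rfl
      rw [h] at hy
      exact (Option.some.inj hy).symm

theorem eps_mul_ofPerm {n : ℕ} (π : Equiv.Perm (Fin n)) (x : Fin n) :
    eps (π x) * ofPerm π = ofPerm π * eps x :=
  gam_ext fun y z => by
    rw [eps_mul_eq_some, mul_eps_eq_some]
    simp only [ofPerm_eq_some]
    refine and_congr_right fun hy => not_congr ?_
    rw [← hy, π.injective.eq_iff]

theorem mul_epsProd_mul_eps {n : ℕ} (a : Alg n) {x : Fin n} {I : Finset (Fin n)} (hx : x ∈ I) :
    a * epsProd I * el (eps x) = 0 := by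
  rw [mul_assoc, epsProd_mul_eps hx, mul_zero]

/-- For `x ∈ P` the outer factors `ε(P)` annihilate `ε_x` on both sides. For `x ∈ Q`, `ε_x` passes
`ε(P)` and `σ` (which fixes `x`), turns into the idempotent of `c⁻¹ x ∈ Q` when it passes the cycles
`c`, and is then killed by `ε(Q)`. For other tail points, `ε_x` commutes with every factor. -/
theorem eps_mul_term {m d : ℕ} {α : GamZ m} {μ : Ptn} {P Q : Finset (Fin (m + d))}
    {σ : Gam (m + d)} (hσ : σ ∈ gamSet α P) {w : List (Fin (m + d))}
    (hw : w ∈ Multiset.lists Q.val) {x : Fin (m + d)} (hx : x ∈ tailPts m (m + d)) :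
    (x ∈ P ∪ Q → el (eps x) *
      (epsProd P * el σ * el (ofPerm (cycles μ w)) * epsProd Q * epsProd P) = 0) ∧
    Commute (el (eps x))
      (epsProd P * el σ * el (ofPerm (cycles μ w)) * epsProd Q * epsProd P) := by
  set c := cycles μ w with hc
  obtain ⟨-, hwQ, -⟩ := mem_lists_val hw
  by_cases hP : x ∈ P
  · have h1 : el (eps x) * (epsProd P * el σ * el (ofPerm c) * epsProd Q * epsProd P) = 0 := by
      simp only [← mul_assoc]
      rw [eps_mul_epsProd hP]
      simp only [zero_mul]
    have h2 := mul_epsProd_mul_eps (epsProd P * el σ * el (ofPerm c) * epsProd Q) hP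
    exact ⟨fun _ => h1, h1.trans h2.symm⟩
  have hcomm : Commute (el (eps x) : Alg (m + d)) (el σ) := by
    change _ * _ = _ * _
    rw [← el_mul, ← el_mul, eps_comm_of_fix ((mem_gamSet.1 hσ).2.2.2 x hx hP)]
  by_cases hQ : x ∈ Q
  · have hcc : c (c⁻¹ x) = x := c.apply_symm_apply x
    have hy : c⁻¹ x ∈ Q := by
      by_contra hn
      have : c (c⁻¹ x) = c⁻¹ x := cycles_apply_of_notMem μ (by rwa [hwQ])
      rw [hcc] at this
      exact hn (this ▸ hQ)
    have h1 : el (eps x) * (epsProd P * el σ * el (ofPerm c) * epsProd Q * epsProd P) = 0 := by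
      calc _ = el (eps x) * (epsProd P * el σ) * el (ofPerm c) * epsProd Q * epsProd P := by
            simp only [mul_assoc]
        _ = epsProd P * el σ * (el (eps (c (c⁻¹ x)) * ofPerm c)) * epsProd Q * epsProd P := by
            rw [((commute_epsProd x P).mul_right hcomm).eq, hcc, el_mul]
            simp only [mul_assoc]
        _ = epsProd P * el σ * el (ofPerm c) * (el (eps (c⁻¹ x)) * epsProd Q) * epsProd P := by
            rw [eps_mul_ofPerm, el_mul]
            simp only [mul_assoc]
        _ = 0 := by rw [eps_mul_epsProd hy, mul_zero, zero_mul]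
    have h2 : epsProd P * el σ * el (ofPerm c) * epsProd Q * epsProd P * el (eps x) = 0 := by
      rw [mul_assoc, ← (commute_epsProd x P).eq, ← mul_assoc, mul_epsProd_mul_eps _ hQ, zero_mul]
    exact ⟨fun _ => h1, h1.trans h2.symm⟩
  · refine ⟨fun h => absurd h (by simp [hP, hQ]), ?_⟩
    have hcx : c x = x := cycles_apply_of_notMem μ (by rwa [hwQ])
    have hcomm' : Commute (el (eps x) : Alg (m + d)) (el (ofPerm c)) := by
      change _ * _ = _ * _
      have := eps_mul_ofPerm c x
      rw [hcx] at this
      rw [← el_mul, ← el_mul, this]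
    exact ((((commute_epsProd x P).mul_right hcomm).mul_right hcomm').mul_right
      (commute_epsProd x Q)).mul_right (commute_epsProd x P)

theorem eps_mul_deltaTerm {m d : ℕ} (α : GamZ m) (μ : Ptn) {P Q : Finset (Fin (m + d))}
    {x : Fin (m + d)} (hx : x ∈ tailPts m (m + d)) (hxPQ : x ∈ P ∪ Q) :
    el (eps x) * deltaTerm α μ P Q = 0 :=
  deltaTerm_mem (LinearMap.ker (LinearMap.mulLeft ℂ (el (eps x))))
    fun _ hσ _ hw => (eps_mul_term hσ hw hx).1 hxPQ

theorem commute_eps_deltaN {m d : ℕ} (α : GamZ m) (μ : Ptn) {x : Fin (m + d)}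
    (hx : x ∈ tailPts m (m + d)) : Commute (el (eps x)) (deltaN α μ d) := by
  have h : deltaN α μ d ∈ LinearMap.ker
      (LinearMap.mulLeft ℂ (el (eps x)) - LinearMap.mulRight ℂ (el (eps x))) := by
    refine deltaN_mem _ fun P Q _ _ _ _ _ => deltaTerm_mem _ fun σ hσ w hw => ?_
    rw [LinearMap.mem_ker, LinearMap.sub_apply, LinearMap.mulLeft_apply, LinearMap.mulRight_apply,
      sub_eq_zero]
    exact (eps_mul_term hσ hw hx).2
  rwa [LinearMap.mem_ker, LinearMap.sub_apply, LinearMap.mulLeft_apply, LinearMap.mulRight_apply,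
    sub_eq_zero] at h

theorem ofPerm_mul_eq_push {n : ℕ} (π : Equiv.Perm (Fin n)) (γ : Gam n) :
    ofPerm π * γ = push π.toEmbedding γ * ofPerm π :=
  gam_ext fun x y => by
    simp only [mul_eq_some, ofPerm_eq_some]
    constructor
    · rintro ⟨z, hz, rfl⟩
      exact ⟨π x, rfl, (push_apply_apply π.toEmbedding γ x z).2 hz⟩
    · rintro ⟨_, rfl, h⟩
      obtain ⟨z, rfl, hz⟩ := (push_apply π.toEmbedding γ x y).1 h
      exact ⟨z, hz, rfl⟩

theorem el_ofPerm_mul {n : ℕ} (π : Equiv.Perm (Fin n)) (a : Alg n) :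
    el (ofPerm π) * a = pushAlg π.toEmbedding a * el (ofPerm π) := by
  rw [eq_sum_el a, Finset.mul_sum, map_sum, Finset.sum_mul]
  refine Finset.sum_congr rfl fun γ _ => ?_
  rw [mul_smul_comm, map_smul, smul_mul_assoc, pushAlg_el, ← el_mul, ← el_mul, ofPerm_mul_eq_push]

theorem fixHead_perm {m d : ℕ} {π : Equiv.Perm (Fin (m + d))}
    (h : ∀ x : Fin (m + d), x.val < m → π x = x) : FixHead π.toEmbedding where
  head j := h _ (by simp)
  tail x := by
    rw [mem_tailPts, mem_tailPts]
    change m ≤ (π x).val ↔ _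
    constructor
    · intro hx
      by_contra hc
      rw [h x (by omega)] at hx
      exact hc hx
    · intro hx
      by_contra hc
      have := π.injective (h (π x) (by omega))
      rw [this] at hc
      exact hc hx

theorem map_tailPts {m d : ℕ} {f : Fin (m + d) ↪ Fin (m + d)} (hf : FixHead f) :
    (tailPts m (m + d)).map f = tailPts m (m + d) := by
  refine Finset.eq_of_subset_of_card_le (fun x hx => ?_) (by rw [Finset.card_map])
  obtain ⟨y, hy, rfl⟩ := Finset.mem_map.1 hx
  exact (hf.tail y).2 hy

theorem commute_ofPerm_deltaN {m d : ℕ} (α : GamZ m) (μ : Ptn) {π : Equiv.Perm (Fin (m + d))}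
    (h : ∀ x : Fin (m + d), x.val < m → π x = x) :
    Commute (el (ofPerm π)) (deltaN α μ d) := by
  have hf := fixHead_perm h
  change _ * _ = _ * _
  rw [el_ofPerm_mul, hf.pushAlg_deltaN, map_tailPts hf, deltaN_eq]

/-- `Γ_m(n)` is generated by the permutations and by the idempotents `ε_x` that it contains. -/
theorem gamFix_induction {m n : ℕ} {p : Gam n → Prop}
    (hperm : ∀ π : Equiv.Perm (Fin n), (∀ x, x.val < m → π x = x) → p (ofPerm π))
    (hmul : ∀ γ x, p γ → x ∈ tailPts m n → p (γ * eps x)) {γ : Gam n} (hγ : γ ∈ gamFix m n) :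
    p γ := by
  classical
  obtain ⟨π, hπ⟩ : ∃ π : Equiv.Perm (Fin n), ∀ x y, γ x = some y → π x = y := by
    obtain ⟨g, hg⟩ := Set.MapsTo.exists_equiv_extend_of_card_eq (α := Fin n) (β := Fin n)
      (t := Finset.univ) (by simp) (s := {x | ∃ y, γ x = some y}) (f := fun x => (γ x).getD x)
      (fun x _ => by simp) (by
        rintro x ⟨y, hy⟩ x' ⟨y', hy'⟩ h
        simp only [hy, hy', Option.getD_some] at h
        subst h
        exact gam_inj γ hy hy')
    refine ⟨g.trans (Equiv.subtypeUnivEquiv fun x => Finset.mem_univ x), fun x y hxy => ?_⟩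
    have := hg x ⟨y, hxy⟩
    simpa [hxy] using this
  -- `γ` is the restriction of the permutation `π` to the domain of `γ`. The points where `γ` is
  -- undefined are tail points, and they are removed one at a time by right factors `eps x`.
  have key : ∀ I : Finset (Fin n), I ⊆ tailPts m n →
      ∃ δ : Gam n, p δ ∧ ∀ x y, δ x = some y ↔ π x = y ∧ x ∉ I := by
    intro I
    induction I using Finset.induction_on with
    | empty =>
      intro _
      exact ⟨_, hperm π fun x hx => hπ x x (hγ x hx), fun x y => by simp [ofPerm_eq_some]⟩
    | insert z I hz ih =>
      intro hI
      obtain ⟨δ, hδ, h⟩ := ih ((Finset.subset_insert z I).trans hI)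
      refine ⟨_, hmul δ z hδ (hI (Finset.mem_insert_self z I)), fun x y => ?_⟩
      rw [mul_eps_eq_some, h, Finset.mem_insert]
      tauto
  obtain ⟨δ, hδ, h⟩ := key (Finset.univ.filter fun x => γ x = none) (by
    intro x hx
    rw [mem_tailPts]
    by_contra hc
    have := hγ x (by omega)
    simp [this] at hx)
  have : δ = γ := gam_ext fun x y => by
    rw [h]
    simp only [Finset.mem_filter, Finset.mem_univ, true_and]
    constructor
    · rintro ⟨rfl, hx⟩
      obtain ⟨y, hy⟩ := Option.ne_none_iff_exists'.1 hx
      rw [hy, hπ x y hy]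
    · intro hxy
      exact ⟨hπ x y hxy, by simp [hxy]⟩
  rwa [← this]

theorem mem_centr {m n : ℕ} {a : Alg n}
    (hperm : ∀ π : Equiv.Perm (Fin n), (∀ x, x.val < m → π x = x) → Commute (el (ofPerm π)) a)
    (heps : ∀ x ∈ tailPts m n, Commute (el (eps x)) a) : a ∈ centr m n := by
  refine (Subalgebra.mem_centralizer_iff ℂ).2 ?_
  rintro _ ⟨γ, hγ, rfl⟩
  refine gamFix_induction (p := fun γ => el γ * a = a * el γ) hperm (fun γ x h hx => ?_) hγ
  rw [el_mul]
  exact Commute.mul_left h (heps x hx)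

theorem commute_eps_of_mem_centr {m n : ℕ} {a : Alg n} (ha : a ∈ centr m n) {x : Fin n}
    (hx : x ∈ tailPts m n) : Commute (el (eps x)) a := by
  refine (Subalgebra.mem_centralizer_iff ℂ).1 ha _ ⟨_, fun y hy => ?_, rfl⟩
  rw [eps_eq_some]
  refine ⟨rfl, ?_⟩
  rintro rfl
  rw [mem_tailPts] at hx
  omega

theorem commute_ofPerm_of_mem_centr {m n : ℕ} {a : Alg n} (ha : a ∈ centr m n)
    {π : Equiv.Perm (Fin n)} (hπ : ∀ x, x.val < m → π x = x) : Commute (el (ofPerm π)) a :=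
  (Subalgebra.mem_centralizer_iff ℂ).1 ha _
    ⟨_, fun y hy => (ofPerm_eq_some π y y).2 (hπ y hy), rfl⟩

theorem deltaN_mem_centr {m : ℕ} (α : GamZ m) (μ : Ptn) (d : ℕ) :
    deltaN α μ d ∈ centr m (m + d) :=
  mem_centr (fun _ hπ => commute_ofPerm_deltaN α μ hπ) fun _ hx => commute_eps_deltaN α μ hx

/-! Compatibility of the `Δ` with `θ`. -/

theorem theta_eq_zero {n : ℕ} {a : Alg (n + 1)} (h : el (eps (Fin.last n)) * a = 0) :
    theta n a = 0 := by
  apply extLin_injective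
  rw [extLin_theta, h, zero_mul, map_zero]

theorem theta_pushAlg {n : ℕ} (a : Alg n) : theta n (pushAlg Fin.castSuccEmb a) = a := by
  rw [eq_sum_el a, map_sum, map_sum]
  refine Finset.sum_congr rfl fun γ _ => ?_
  rw [map_smul, map_smul, pushAlg_el, theta_el]
  congr 2
  refine gam_ext fun x y => ?_
  rw [corner_eq_some]
  exact push_apply_apply Fin.castSuccEmb γ x y

theorem fixHead_castSucc (m d : ℕ) :
    FixHead (d := d + 1) (Fin.castSuccEmb : Fin (m + d) ↪ Fin (m + d + 1)) where
  head _ := rfl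
  tail x := by
    rw [mem_tailPts, mem_tailPts]
    rfl

theorem last_mem_tailPts (m d : ℕ) : Fin.last (m + d) ∈ tailPts m (m + (d + 1)) := by
  rw [mem_tailPts]
  simp

theorem subset_map_castSucc {m d : ℕ} {I : Finset (Fin (m + d + 1))}
    (hI : I ⊆ tailPts m (m + (d + 1))) (hlast : Fin.last (m + d) ∉ I) :
    I ⊆ (tailPts m (m + d)).map Fin.castSuccEmb := by
  intro x hx
  have hxl : x ≠ Fin.last _ := fun h => hlast (h ▸ hx)
  refine Finset.mem_map.2 ⟨x.castPred hxl, ?_, by simp⟩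
  have := (mem_tailPts x).1 (hI hx)
  rw [mem_tailPts]
  simpa using this

/-- Summands with the last point in `P ∪ Q` are annihilated by its idempotent, hence by `θ`. The
others are the images under `pushAlg` of the summands one level below, and `θ` inverts `pushAlg`. -/
theorem theta_deltaN {m : ℕ} (α : GamZ m) (μ : Ptn) (d : ℕ) :
    theta (m + d) (deltaN α μ (d + 1)) = deltaN α μ d := by
  have hf := fixHead_castSucc m d
  have hsub : (tailPts m (m + d)).map Fin.castSuccEmb ⊆ tailPts m (m + (d + 1)) := by
    intro x hx
    obtain ⟨y, hy, rfl⟩ := Finset.mem_map.1 hx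
    exact (hf.tail y).2 hy
  conv_rhs => rw [← theta_pushAlg (deltaN α μ d), hf.pushAlg_deltaN]
  rw [deltaN_eq, map_sum, map_sum]
  simp only [map_sum]
  symm
  refine Finset.sum_subset_zero_on_sdiff (Finset.powersetCard_mono hsub) ?_ ?_
  · intro P hP
    rw [Finset.mem_sdiff, Finset.mem_powersetCard, Finset.mem_powersetCard] at hP
    refine Finset.sum_eq_zero fun Q _ => theta_eq_zero ?_
    refine eps_mul_deltaTerm α μ (last_mem_tailPts m d) (Finset.mem_union_left _ ?_)
    by_contra hc
    exact hP.2 ⟨subset_map_castSucc hP.1.1 hc, hP.1.2⟩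
  · intro P hP
    refine Finset.sum_subset_zero_on_sdiff
      (Finset.powersetCard_mono (Finset.sdiff_subset_sdiff hsub le_rfl)) ?_ fun _ _ => rfl
    intro Q hQ
    rw [Finset.mem_sdiff, Finset.mem_powersetCard, Finset.mem_powersetCard] at hQ
    have hdisj : Disjoint P Q := Finset.disjoint_of_subset_right hQ.1.1 Finset.disjoint_sdiff
    refine theta_eq_zero (eps_mul_deltaTerm α μ (last_mem_tailPts m d)
      (Finset.mem_union_right _ ?_))
    by_contra hc
    refine hQ.2 ⟨fun x hx => ?_, hQ.1.2⟩
    exact Finset.mem_sdiff.2 ⟨subset_map_castSucc (hQ.1.1.trans Finset.sdiff_subset) hc hx,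
      Finset.disjoint_right.1 hdisj hx⟩

/-! The degree of `Δ`. -/

/-- The algebra spanned by the `γ` fixing the points other than the first `m` ones outside `I`. -/
noncomputable def fixAlg (m : ℕ) {n : ℕ} (I : Finset (Fin n)) : Subalgebra ℂ (Alg n) :=
  Algebra.adjoin ℂ ((fun γ => el γ) '' {γ : Gam n | ∀ x ∈ tailPts m n, x ∉ I → γ x = some x})

theorem el_mem_fixAlg {m n : ℕ} {I : Finset (Fin n)} {γ : Gam n}
    (h : ∀ x ∈ tailPts m n, x ∉ I → γ x = some x) : el γ ∈ fixAlg m I :=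
  Algebra.subset_adjoin ⟨γ, h, rfl⟩

theorem epsProd_mem_fixAlg {m n : ℕ} {I J : Finset (Fin n)} (hJ : J ⊆ I) :
    epsProd J ∈ fixAlg m I := by
  induction J using Finset.induction_on with
  | empty => rw [epsProd_empty]; exact one_mem _
  | insert x J hx ih =>
    rw [epsProd_insert hx]
    refine mul_mem (sub_mem (one_mem _) (el_mem_fixAlg fun y _ hyI => ?_))
      (ih ((Finset.subset_insert x J).trans hJ))
    rw [eps_eq_some]
    refine ⟨rfl, ?_⟩
    rintro rfl
    exact hyI (hJ (Finset.mem_insert_self y J))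

theorem fixAlg_le_filt (m : ℕ) {n : ℕ} (I : Finset (Fin n)) :
    Subalgebra.toSubmodule (fixAlg m I) ≤ filt m n I.card := by
  -- The generators are closed under multiplication, so the algebra they generate is just their
  -- linear span.
  let S : Submonoid (Gam n) :=
    { carrier := {γ : Gam n | ∀ x ∈ tailPts m n, x ∉ I → γ x = some x}
      one_mem' := fun _ _ _ => rfl
      mul_mem' := fun {γ δ} hγ hδ x hx hxI =>
        (mul_eq_some γ δ x x).2 ⟨x, hδ x hx hxI, hγ x hx hxI⟩ }
  have h : Subalgebra.toSubmodule (fixAlg m I) =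
      Submodule.span ℂ ((fun γ => el γ) '' (S : Set (Gam n))) := by
    unfold fixAlg
    rw [Algebra.adjoin_eq_span]
    congr 1
    exact congrArg _ (Submonoid.closure_eq (S.map (MonoidAlgebra.of ℂ (Gam n))))
  rw [h]
  refine Submodule.span_mono (Set.image_mono fun γ hγ => Finset.card_le_card fun x hx => ?_)
  by_contra hxI
  rw [Finset.mem_filter] at hx
  exact hx.2.2 (hγ x ((mem_tailPts x).2 hx.2.1) hxI)

theorem deltaN_mem_filt {m : ℕ} (α : GamZ m) (μ : Ptn) (d : ℕ) :
    deltaN α μ d ∈ filt m (m + d) (α.ord + μ.size) := by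
  refine deltaN_mem _ fun P Q _ _ hPQ hP hQ => ?_
  rw [← hP, ← hQ, ← Finset.card_union_of_disjoint hPQ]
  refine fixAlg_le_filt m (P ∪ Q) (deltaTerm_mem _ fun σ hσ w hw => ?_)
  rw [Subalgebra.mem_toSubmodule]
  refine mul_mem (mul_mem (mul_mem (mul_mem ?_ (el_mem_fixAlg ?_)) (el_mem_fixAlg ?_)) ?_) ?_
  · exact epsProd_mem_fixAlg Finset.subset_union_left
  · exact fun x hx hxI => (mem_gamSet.1 hσ).2.2.2 x hx fun h => hxI (Finset.mem_union_left _ h)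
  · intro x hx hxI
    rw [ofPerm_eq_some]
    refine cycles_apply_of_notMem μ fun h => hxI (Finset.mem_union_right _ ?_)
    exact ((mem_lists_val hw).2.1 x).1 h
  · exact epsProd_mem_fixAlg Finset.subset_union_right
  · exact epsProd_mem_fixAlg Finset.subset_union_left

/-- Boundedness in `A_m` is measured by the degree `deg_0`, the filtration by `deg_m`. The two
differ by at most `m`, so they give the same notion of bounded degree. -/
theorem degm_zero_le {m n : ℕ} (γ : Gam n) : degm 0 γ ≤ m + degm m γ := by
  unfold degm
  have h1 : (Finset.univ.filter fun x : Fin n => x.val < m).card ≤ m := by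
    have : (Finset.univ.filter fun x : Fin n => x.val < m).card ≤ (Finset.range m).card :=
      Finset.card_le_card_of_injOn Fin.val (fun x hx => by simpa using hx)
        Fin.val_injective.injOn
    simpa using this
  refine le_trans (Finset.card_le_card ?_)
    ((Finset.card_union_le _ _).trans (Nat.add_le_add_right h1 _))
  intro x
  simp only [Finset.mem_filter, Finset.mem_univ, true_and, Finset.mem_union]
  rintro ⟨-, hx⟩
  exact (lt_or_ge x.val m).imp id fun h => ⟨h, hx⟩

theorem filt_le_filt_zero (m n N : ℕ) : filt m n N ≤ filt 0 n (m + N) :=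
  Submodule.span_mono (Set.image_mono fun γ hγ =>
    (degm_zero_le γ).trans (Nat.add_le_add_left hγ m))

theorem filt_zero_le_filt (m n N : ℕ) : filt 0 n N ≤ filt m n N :=
  Submodule.span_mono (Set.image_mono fun γ hγ => le_trans (Finset.card_le_card fun x hx => by
    simp only [Finset.mem_filter, Finset.mem_univ, true_and] at hx ⊢
    exact ⟨Nat.zero_le _, hx.2⟩) hγ)

/-- `Δ^{α,𝓜}` as an element of `A_m`. -/
noncomputable def delta {m : ℕ} (x : GamZ m × Ptn) : limAlg m :=
  ⟨deltaN x.1 x.2, fun d => deltaN_mem_centr x.1 x.2 d, fun d => theta_deltaN x.1 x.2 d,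
    m + (x.1.ord + x.2.size), fun d => filt_le_filt_zero _ _ _ (deltaN_mem_filt x.1 x.2 d)⟩

theorem delta_mem_limFilt {m N : ℕ} {x : GamZ m × Ptn} (hx : x.1.ord + x.2.size ≤ N) :
    delta x ∈ limFilt m N :=
  fun d => filt_mono hx (deltaN_mem_filt x.1 x.2 d)

/-! Cycle types. -/

theorem cycleType_formPerm {n : ℕ} {l : List (Fin n)} (hl : l.Nodup) :
    l.formPerm.cycleType = if 2 ≤ l.length then {l.length} else 0 := by
  split_ifs with h
  · rw [(List.isCycle_formPerm hl h).cycleType, List.support_formPerm_of_nodup l hl,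
      List.toFinset_card_of_nodup hl]
    rintro x rfl
    simp at h
  · rw [Equiv.Perm.cycleType_eq_zero, List.formPerm_eq_one_iff _ hl]
    omega

/-- The pieces cut from a word without repetitions have disjoint supports, so their cycle types add.
Pieces of length at most `1` give the identity, hence the filter. -/
theorem cycleType_prod_formPerm {n : ℕ} (L : List ℕ) {w : List (Fin n)} (hw : w.Nodup)
    (hL : L.sum = w.length) :
    ((L.splitLengths w).map List.formPerm).prod.cycleType =
      (L : Multiset ℕ).filter (2 ≤ ·) := by
  induction L generalizing w with
  | nil => simp
  | cons k L ih =>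
    rw [List.sum_cons] at hL
    have hdisj : Equiv.Perm.Disjoint (w.take k).formPerm
        ((L.splitLengths (w.drop k)).map List.formPerm).prod := by
      intro x
      by_cases hx : x ∈ w.take k
      · right
        refine prod_formPerm_apply_of_notMem _ _ fun v hv hxv => ?_
        exact List.disjoint_take_drop hw le_rfl hx (mem_of_mem_splitLengths hv hxv)
      · exact Or.inl (List.formPerm_apply_of_notMem hx)
    have hk : (w.take k).length = k := by
      rw [List.length_take]
      omega
    rw [List.splitLengths_cons, List.map_cons, List.prod_cons, hdisj.cycleType_mul,
      ih (hw.sublist (List.drop_sublist k w)) (by rw [List.length_drop]; omega),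
      cycleType_formPerm (hw.sublist (List.take_sublist k w)), hk, ← Multiset.cons_coe,
      Multiset.filter_cons]

theorem Ptn.coe_list (μ : Ptn) : (μ.list : Multiset ℕ) = μ.2.parts :=
  Multiset.sort_eq _ _

theorem Ptn.sum_list (μ : Ptn) : μ.list.sum = μ.size := by
  rw [← Multiset.sum_coe, μ.coe_list, μ.2.parts_sum]

theorem cycleType_cycles {n : ℕ} (μ : Ptn) {w : List (Fin n)} (hw : w.Nodup)
    (hμ : μ.size = w.length) : (cycles μ w).cycleType = μ.2.parts.filter (2 ≤ ·) := by
  rw [← μ.coe_list]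
  exact cycleType_prod_formPerm _ hw (by rw [μ.sum_list, hμ])

/-- The parts equal to `1`, invisible in the cycle type, are recovered from the size. -/
theorem Ptn.parts_eq (μ : Ptn) : μ.2.parts = μ.2.parts.filter (2 ≤ ·) +
    Multiset.replicate (μ.size - (μ.2.parts.filter (2 ≤ ·)).sum) 1 := by
  have h1 := Multiset.filter_add_not (2 ≤ ·) μ.2.parts
  have h2 : μ.2.parts.filter (fun k => ¬ 2 ≤ k) =
      Multiset.replicate (μ.2.parts.filter (fun k => ¬ 2 ≤ k)).card 1 := by
    rw [Multiset.eq_replicate]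
    refine ⟨rfl, fun k hk => ?_⟩
    rw [Multiset.mem_filter] at hk
    have := μ.2.parts_pos hk.1
    omega
  have h3 := congrArg Multiset.sum h1
  rw [Multiset.sum_add, μ.2.parts_sum] at h3
  have h4 := congrArg Multiset.sum h2
  rw [Multiset.sum_replicate, smul_eq_mul, mul_one] at h4
  conv_lhs => rw [← h1]
  rw [h2]
  congr 2
  change _ = μ.1 - _
  omega

theorem Ptn.eq_of_filter {μ ν : Ptn} (hs : μ.size = ν.size)
    (h : μ.2.parts.filter (2 ≤ ·) = ν.2.parts.filter (2 ≤ ·)) : μ = ν := by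
  have h1 := μ.parts_eq
  rw [h, hs, ← ν.parts_eq] at h1
  obtain ⟨k, p⟩ := μ
  obtain ⟨l, q⟩ := ν
  obtain rfl : k = l := hs
  exact congrArg _ (Nat.Partition.ext h1)

/-- Transport `c` to `Fin Q.card` and let `μ` be its partition, with fixed points counted as parts
`1`. The model product of cycles has the same cycle type, hence is conjugate to `c`, and relabelling
the word by the conjugating permutation turns it into `c`. -/
theorem exists_cycles_eq {n : ℕ} (Q : Finset (Fin n)) (c : Equiv.Perm (Fin n))
    (hc : ∀ x ∉ Q, c x = x) :
    ∃ μ : Ptn, μ.size = Q.card ∧ ∃ w ∈ Multiset.lists Q.val, cycles μ w = c := by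
  have hcQ : ∀ x, c x ∈ Q ↔ x ∈ Q := by
    intro x
    constructor
    · intro h
      by_contra hn
      rw [hc x hn] at h
      exact hn h
    · intro h
      by_contra hn
      have := c.injective (hc (c x) hn)
      rw [this] at hn
      exact hn h
  let e : Fin Q.card ≃ {x // x ∈ Q} := Q.equivFin.symm
  let f : Fin Q.card ↪ Fin n := e.toEmbedding.trans (Function.Embedding.subtype _)
  have hfQ : ∀ x, x ∈ Q ↔ ∃ y, f y = x := fun x =>
    ⟨fun hx => ⟨e.symm ⟨x, hx⟩, by simp [f]⟩, by rintro ⟨y, rfl⟩; exact (e y).2⟩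
  let c' : Equiv.Perm (Fin Q.card) := e.symm.permCongr (c.subtypePerm hcQ)
  have hc' : ∀ x, f (c' x) = c (f x) := fun x => by
    simp [f, c', Equiv.permCongr_apply]
  let μ : Ptn := ⟨Fintype.card (Fin Q.card), c'.partition⟩
  have hμ : μ.size = Q.card := Fintype.card_fin _
  have hconj : IsConj (cycles μ (List.finRange Q.card)) c' := by
    rw [Equiv.Perm.isConj_iff_cycleType_eq, cycleType_cycles μ (List.nodup_finRange _)
      (by rw [hμ, List.length_finRange])]
    change (c'.partition).parts.filter _ = _
    rw [Equiv.Perm.parts_partition, Multiset.filter_add,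
      Multiset.filter_eq_self.2 fun k hk => Equiv.Perm.two_le_of_mem_cycleType hk,
      Multiset.filter_eq_nil.2, add_zero]
    intro k hk
    rw [Multiset.eq_of_mem_replicate hk]
    decide
  obtain ⟨π, hπ⟩ := isConj_iff.1 hconj
  refine ⟨μ, hμ, ((List.finRange Q.card).map π.toEmbedding).map f, ?_, Equiv.ext fun x => ?_⟩
  · rw [Multiset.mem_lists_iff]
    change Q.val = ((List.map f _ : List (Fin n)) : Multiset (Fin n))
    refine (Multiset.Nodup.ext Q.nodup ?_).2 fun x => ?_
    · rw [Multiset.coe_nodup]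
      exact ((List.nodup_finRange _).map π.injective).map f.injective
    · rw [Finset.mem_val, hfQ]
      simp only [Equiv.coe_toEmbedding, Multiset.mem_coe, List.mem_map, List.mem_finRange,
        true_and, exists_exists_eq_and]
      exact ⟨fun ⟨y, hy⟩ => ⟨π.symm y, by simpa using hy⟩, fun ⟨y, hy⟩ => ⟨π y, hy⟩⟩
  · by_cases hx : x ∈ Q
    · obtain ⟨y, rfl⟩ := (hfQ x).1 hx
      rw [cycles_map, ← hc', ← hπ]
      congr 1
      have := cycles_map π.toEmbedding μ (List.finRange Q.card) (π.symm y)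
      simp only [Equiv.coe_toEmbedding, Equiv.apply_symm_apply] at this
      exact this
    · rw [hc x hx, cycles_apply_of_notMem]
      intro h
      obtain ⟨y, -, rfl⟩ := List.mem_map.1 h
      exact hx ((hfQ _).2 ⟨y, rfl⟩)

/-! Paths. -/

theorem castAdd_notMem_tailPts {m d : ℕ} (j : Fin m) : Fin.castAdd d j ∉ tailPts m (m + d) := by
  rw [mem_tailPts]
  simp

theorem exists_castAdd {m d : ℕ} {x : Fin (m + d)} (hx : x ∉ tailPts m (m + d)) :
    ∃ j : Fin m, x = Fin.castAdd d j := by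
  rw [mem_tailPts] at hx
  exact ⟨⟨x.val, by omega⟩, rfl⟩

theorem symm_eq_some {n : ℕ} (γ : Gam n) (x y : Fin n) :
    PEquiv.symm γ x = some y ↔ γ y = some x :=
  PEquiv.eq_some_iff γ

theorem Full.symm {m n : ℕ} {γ : Gam n} (h : Full m γ) : Full m (PEquiv.symm γ : Gam n) :=
  fun x hx => by
    simp only [symm_eq_some]
    exact ⟨(h x hx).2, (h x hx).1⟩

theorem IsPath.reverse {m d : ℕ} {γ : Gam (m + d)} {i j : Fin m} {k : ℕ} {p : ℕ → Fin (m + d)}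
    (h : IsPath γ i j k p) :
    IsPath (PEquiv.symm γ : Gam (m + d)) j i k (fun t => p (k + 1 - t)) := by
  obtain ⟨h0, h1, h2, h3⟩ := h
  refine ⟨by simpa using h1, by simpa using h0, fun t ht ht' => h2 _ (by omega) (by omega),
    fun t ht => ?_⟩
  rw [symm_eq_some]
  have := h3 (k - t) (by omega)
  rwa [show k - t + 1 = k + 1 - t by omega, show k - t = k + 1 - (t + 1) by omega] at this

/-- Both paths follow `γ` from the same start, and each stops at its first return to the first `m`
points. -/
theorem IsPath.eq {m d : ℕ} {γ : Gam (m + d)} {i i' j : Fin m} {k k' : ℕ}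
    {p p' : ℕ → Fin (m + d)} (h : IsPath γ i j k p) (h' : IsPath γ i' j k' p') :
    i = i' ∧ k = k' ∧ ∀ t ≤ k + 1, p t = p' t := by
  have agree : ∀ t, t ≤ k + 1 → t ≤ k' + 1 → p t = p' t := by
    intro t
    induction t with
    | zero => exact fun _ _ => h.1.trans h'.1.symm
    | succ t ih =>
      intro ht ht'
      have h1 := h.2.2.2 t (by omega)
      rw [ih (by omega) (by omega), h'.2.2.2 t (by omega)] at h1
      exact (Option.some.inj h1).symm
  have hk : k = k' := by
    rcases lt_trichotomy k k' with hlt | heq | hlt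
    · have := h'.2.2.1 (k + 1) (by omega) (by omega)
      rw [← agree (k + 1) (by omega) (by omega), h.2.1] at this
      exact absurd this (castAdd_notMem_tailPts i)
    · exact heq
    · have := h.2.2.1 (k' + 1) (by omega) (by omega)
      rw [agree (k' + 1) (by omega) (by omega), h'.2.1] at this
      exact absurd this (castAdd_notMem_tailPts i')
  subst hk
  refine ⟨?_, rfl, fun t ht => agree t ht ht⟩
  have := agree (k + 1) le_rfl le_rfl
  rw [h.2.1, h'.2.1] at this
  exact Fin.castAdd_injective _ _ this

/-- Trace both paths backwards from the common point by injectivity of `γ`. Only index `0` lies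
among the first `m` points, so both reach their start simultaneously. -/
theorem IsPath.index_eq {m d : ℕ} {γ : Gam (m + d)} {i i' j j' : Fin m} {k k' : ℕ}
    {p p' : ℕ → Fin (m + d)} (h : IsPath γ i j k p) (h' : IsPath γ i' j' k' p') (t t' : ℕ)
    (ht : t ≤ k) (ht' : t' ≤ k') (htt : p t = p' t') : t = t' ∧ j = j' := by
  induction t generalizing t' with
  | zero =>
    rw [h.1] at htt
    cases t' with
    | zero =>
      rw [h'.1] at htt
      exact ⟨rfl, Fin.castAdd_injective _ _ htt⟩
    | succ s =>
      exact absurd (htt ▸ h'.2.2.1 (s + 1) (by omega) ht') (castAdd_notMem_tailPts j)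
  | succ t ih =>
    cases t' with
    | zero =>
      rw [h'.1] at htt
      exact absurd (htt ▸ h.2.2.1 (t + 1) (by omega) ht) (castAdd_notMem_tailPts j')
    | succ s =>
      have h1 := h.2.2.2 t (by omega)
      rw [htt] at h1
      have := ih s (by omega) (by omega) (gam_inj γ h1 (h'.2.2.2 s (by omega)))
      exact ⟨by omega, this.2⟩

/-- If the orbit of `j` never returned to the first `m` points, fullness would let it continue
through the tail forever, and injectivity would make its points distinct, contradicting finiteness.
-/
theorem exists_isPath {m d : ℕ} {γ : Gam (m + d)} (hγ : Full m γ) {j : Fin m} {y : Fin (m + d)}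
    (hj : γ (Fin.castAdd d j) = some y) : ∃ i k p, IsPath γ i j k p := by
  by_contra hno
  push Not at hno
  -- The orbit of `j`. The default value of `getD` is harmless, since `key` shows that `γ` is always
  -- defined along the orbit.
  let q : ℕ → Fin (m + d) := fun t =>
    Nat.rec (Fin.castAdd d j) (fun _ x => (γ x).getD x) t
  have hq : ∀ t x, γ (q t) = some x → q (t + 1) = x := by
    intro t x h
    change (γ (q t)).getD (q t) = x
    rw [h, Option.getD_some]
  have key : ∀ t, (∀ s ≤ t, γ (q s) = some (q (s + 1))) ∧
      ∀ s ≤ t, q (s + 1) ∈ tailPts m (m + d) := by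
    intro t
    induction t with
    | zero =>
      have h0 : γ (q 0) = some (q 1) := by
        rw [← zero_add 1, hq 0 y hj]
        exact hj
      refine ⟨fun s hs => by rwa [Nat.le_zero.1 hs], fun s hs => ?_⟩
      rw [Nat.le_zero.1 hs]
      by_contra hc
      obtain ⟨i, hi⟩ := exists_castAdd hc
      refine hno i 0 q ⟨rfl, hi, fun t h h' => by omega, fun t ht => ?_⟩
      rwa [Nat.le_zero.1 ht]
    | succ t ih =>
      obtain ⟨x, hx⟩ := (hγ _ (ih.2 t le_rfl)).1
      have h1 : ∀ s ≤ t + 1, γ (q s) = some (q (s + 1)) := by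
        intro s hs
        rcases Nat.le_succ_iff.1 hs with hs | rfl
        · exact ih.1 s hs
        · rw [hq (t + 1) x hx, hx]
      refine ⟨h1, fun s hs => ?_⟩
      rcases Nat.le_succ_iff.1 hs with hs | rfl
      · exact ih.2 s hs
      · by_contra hc
        obtain ⟨i, hi⟩ := exists_castAdd hc
        refine hno i (t + 1) q ⟨rfl, hi, fun r h h' => ?_, h1⟩
        have := ih.2 (r - 1) (by omega)
        rwa [Nat.sub_add_cancel h] at this
  -- A coincidence is cancelled backwards to index `0`, where `q 0` is a head point while all later
  -- points are tail points.
  refine not_injective_infinite_finite q fun s t hst => ?_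
  induction s generalizing t with
  | zero =>
    cases t with
    | zero => rfl
    | succ t => exact absurd (hst ▸ (key t).2 t le_rfl) (castAdd_notMem_tailPts j)
  | succ s ih =>
    cases t with
    | zero => exact absurd (hst ▸ (key s).2 s le_rfl) (castAdd_notMem_tailPts j)
    | succ t =>
      have h1 := (key s).1 s le_rfl
      rw [hst] at h1
      rw [ih t (gam_inj γ h1 ((key t).1 t le_rfl))]

/-! A model for the partial bijections occurring in `Δ_n^{α,𝓜}`. -/

/-- A set of `ord α` points: `k` intermediate points for every entry `z ^ k` of `α`. -/
abbrev Pts {m : ℕ} (α : GamZ m) : Type :=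
  Σ ij : Fin m × Fin m, Fin ((α.entry ij.1 ij.2).getD 0)

theorem card_pts {m : ℕ} (α : GamZ m) : Fintype.card (Pts α) = α.ord := by
  rw [Fintype.card_sigma, Fintype.sum_prod_type]
  simp only [Fintype.card_fin]
  rfl

/-- The set on which the partial bijections are modelled: `m` points, the points of the paths,
and `q` further points. -/
abbrev Model {m : ℕ} (α : GamZ m) (q : ℕ) : Type := Fin m ⊕ (Pts α ⊕ Fin q)

/-- The path from `j` to `i` in the model. -/
def node {m : ℕ} (α : GamZ m) (q : ℕ) (i j : Fin m) : ℕ → Model α q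
  | 0 => Sum.inl j
  | t + 1 => if h : t < (α.entry i j).getD 0 then Sum.inr (Sum.inl ⟨(i, j), ⟨t, h⟩⟩) else Sum.inl i

section Node

variable {m : ℕ} {α : GamZ m} {q : ℕ}

theorem node_succ_of_lt {i j : Fin m} {t : ℕ} (h : t < (α.entry i j).getD 0) :
    node α q i j (t + 1) = Sum.inr (Sum.inl ⟨(i, j), ⟨t, h⟩⟩) :=
  dif_pos h

theorem node_last {i j : Fin m} {k : ℕ} (h : α.entry i j = some k) :
    node α q i j (k + 1) = Sum.inl i :=
  dif_neg (by simp [h])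

/-- The position of a point of a path. -/
def nodeIndex : Model α q → Option ((Fin m × Fin m) × ℕ)
  | Sum.inr (Sum.inl x) => some (x.1, x.2.val)
  | _ => none

theorem nodeIndex_succ {i j : Fin m} {t : ℕ} (h : t < (α.entry i j).getD 0) :
    nodeIndex (node α q i j (t + 1)) = some ((i, j), t) := by
  rw [node_succ_of_lt h]
  rfl

/-- An intermediate node carries its path and position. A starting node carries only the column `j`,
and `col_unique` then determines the row. -/
theorem node_source_eq {i j i' j' : Fin m} {k k' t t' : ℕ} (h : α.entry i j = some k)
    (h' : α.entry i' j' = some k') (ht : t ≤ k) (ht' : t' ≤ k')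
    (e : node α q i j t = node α q i' j' t') : i = i' ∧ j = j' ∧ t = t' := by
  cases t with
  | zero =>
    cases t' with
    | zero =>
      obtain rfl := Sum.inl.inj e
      exact ⟨α.col_unique i i' j (by simp [h]) (by simp [h']), rfl, rfl⟩
    | succ t' =>
      have := congrArg nodeIndex e
      rw [nodeIndex_succ (by simpa [h'] using ht')] at this
      cases this
  | succ t =>
    have := congrArg nodeIndex e
    rw [nodeIndex_succ (by simpa [h] using ht)] at this
    cases t' with
    | zero => cases this
    | succ t' =>
      rw [nodeIndex_succ (by simpa [h'] using ht')] at this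
      simp only [Option.some.injEq, Prod.mk.injEq] at this
      exact ⟨this.1.1, this.1.2, by rw [this.2]⟩

/-- Dual to `node_source_eq`: a final node carries only the row `i`, and `row_unique` determines the
column. -/
theorem node_target_eq {i j i' j' : Fin m} {k k' t t' : ℕ} (h : α.entry i j = some k)
    (h' : α.entry i' j' = some k') (ht : t ≤ k) (ht' : t' ≤ k')
    (e : node α q i j (t + 1) = node α q i' j' (t' + 1)) : i = i' ∧ j = j' ∧ t = t' := by
  have e' := congrArg nodeIndex e
  rcases ht.lt_or_eq with ht | rfl
  · rw [nodeIndex_succ (by simpa [h] using ht)] at e'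
    rcases ht'.lt_or_eq with ht' | rfl
    · rw [nodeIndex_succ (by simpa [h'] using ht')] at e'
      simp only [Option.some.injEq, Prod.mk.injEq] at e'
      exact ⟨e'.1.1, e'.1.2, e'.2⟩
    · rw [node_last h'] at e'
      cases e'
  · rcases ht'.lt_or_eq with ht' | rfl
    · rw [node_last h, nodeIndex_succ (by simpa [h'] using ht')] at e'
      cases e'
    · rw [node_last h, node_last h'] at e
      obtain rfl := Sum.inl.inj e
      obtain rfl := α.row_unique i j j' (by simp [h]) (by simp [h'])
      rw [h] at h'
      exact ⟨rfl, rfl, Option.some.inj h'⟩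

/-- The graph of the partial bijection of the model. -/
def ModelRel (a b : Model α q) : Prop :=
  (∃ i j k, α.entry i j = some k ∧ ∃ t ≤ k, a = node α q i j t ∧ b = node α q i j (t + 1)) ∨
    ∃ s, a = Sum.inr (Sum.inr s) ∧ b = Sum.inr (Sum.inr s)

theorem node_ne_inr (i j : Fin m) (t : ℕ) (s : Fin q) :
    node α q i j t ≠ Sum.inr (Sum.inr s) := by
  cases t with
  | zero => rintro ⟨⟩
  | succ t =>
    by_cases h : t < (α.entry i j).getD 0
    · rw [node_succ_of_lt h]
      rintro ⟨⟩
    · rw [show node α q i j (t + 1) = Sum.inl i from dif_neg h]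
      rintro ⟨⟩

theorem ModelRel.right_unique {a b b' : Model α q} (h : ModelRel a b) (h' : ModelRel a b') :
    b = b' := by
  rcases h with ⟨i, j, k, h, t, ht, rfl, rfl⟩ | ⟨s, rfl, rfl⟩
  · rcases h' with ⟨i', j', k', h', t', ht', e, rfl⟩ | ⟨s, e, -⟩
    · obtain ⟨rfl, rfl, rfl⟩ := node_source_eq h h' ht ht' e
      rfl
    · exact absurd e (node_ne_inr _ _ _ _)
  · rcases h' with ⟨i', j', k', h', t', ht', e, rfl⟩ | ⟨s', e, rfl⟩
    · exact absurd e.symm (node_ne_inr _ _ _ _)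
    · exact e

theorem ModelRel.left_unique {a a' b : Model α q} (h : ModelRel a b) (h' : ModelRel a' b) :
    a = a' := by
  rcases h with ⟨i, j, k, h, t, ht, rfl, rfl⟩ | ⟨s, rfl, rfl⟩
  · rcases h' with ⟨i', j', k', h', t', ht', rfl, e⟩ | ⟨s, rfl, e⟩
    · obtain ⟨rfl, rfl, rfl⟩ := node_target_eq h h' ht ht' e
      rfl
    · exact absurd e (node_ne_inr _ _ _ _)
  · rcases h' with ⟨i', j', k', h', t', ht', rfl, e⟩ | ⟨s', rfl, e⟩
    · exact absurd e.symm (node_ne_inr _ _ _ _)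
    · exact e

theorem exists_entry (x : Pts α) : ∃ k, α.entry x.1.1 x.1.2 = some k ∧ x.2.val < k := by
  -- Stated for an arbitrary option, because the type of `x.2` depends on the entry and obstructs a
  -- direct case split.
  have key : ∀ (o : Option ℕ) (t : ℕ), t < o.getD 0 → ∃ k, o = some k ∧ t < k := by
    rintro (_ | k) t h
    · simp at h
    · exact ⟨k, rfl, h⟩
  exact key _ _ x.2.2

theorem exists_node_eq (x : Pts α) : ∃ i j k t, α.entry i j = some k ∧ t < k ∧
    node α q i j (t + 1) = Sum.inr (Sum.inl x) := by
  obtain ⟨k, h, ht⟩ := exists_entry x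
  exact ⟨_, _, k, _, h, ht, node_succ_of_lt x.2.2⟩

theorem exists_pts_eq {i j : Fin m} {k t : ℕ} (h : α.entry i j = some k) (h1 : 1 ≤ t)
    (h2 : t ≤ k) : ∃ x : Pts α, node α q i j t = Sum.inr (Sum.inl x) := by
  obtain ⟨t, rfl⟩ := Nat.exists_eq_add_of_le' h1
  exact ⟨_, node_succ_of_lt (by simpa [h] using h2)⟩

end Node

/-- A labelling of the points of the model that is the identity on the first `m` points. -/
structure Labelling {m : ℕ} (α : GamZ m) (q d : ℕ) where
  toEquiv : Model α q ≃ Fin (m + d)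
  head : ∀ j, toEquiv (Sum.inl j) = Fin.castAdd d j

namespace Labelling

variable {m q d : ℕ} {α : GamZ m} (E : Labelling α q d)

theorem inr_mem_tailPts (a : Pts α ⊕ Fin q) : E.toEquiv (Sum.inr a) ∈ tailPts m (m + d) := by
  by_contra hc
  obtain ⟨j, hj⟩ := exists_castAdd hc
  rw [← E.head, E.toEquiv.injective.eq_iff] at hj
  cases hj

/-- The partial bijection defined by a labelling. -/
noncomputable def gam : Gam (m + d) :=
  ofRel (fun x y => ModelRel (E.toEquiv.symm x) (E.toEquiv.symm y))
    (fun _ _ _ h h' => E.toEquiv.symm.injective (h.right_unique h'))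
    (fun _ _ _ h h' => E.toEquiv.symm.injective (h.left_unique h'))

theorem gam_eq_some (a b : Model α q) :
    E.gam (E.toEquiv a) = some (E.toEquiv b) ↔ ModelRel a b := by
  unfold gam
  rw [ofRel_eq_some, Equiv.symm_apply_apply, Equiv.symm_apply_apply]

theorem gam_node {i j : Fin m} {k t : ℕ} (h : α.entry i j = some k) (ht : t ≤ k) :
    E.gam (E.toEquiv (node α q i j t)) = some (E.toEquiv (node α q i j (t + 1))) :=
  (E.gam_eq_some _ _).2 (Or.inl ⟨i, j, k, h, t, ht, rfl, rfl⟩)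

theorem gam_rest (s : Fin q) :
    E.gam (E.toEquiv (Sum.inr (Sum.inr s))) = some (E.toEquiv (Sum.inr (Sum.inr s))) :=
  (E.gam_eq_some _ _).2 (Or.inr ⟨s, rfl, rfl⟩)

/-- The points labelled by the points of the paths. -/
def pathPts : Finset (Fin (m + d)) :=
  Finset.univ.map ((Function.Embedding.inl.trans Function.Embedding.inr).trans
    E.toEquiv.toEmbedding : Pts α ↪ Fin (m + d))

/-- The remaining points. -/
def restPts : Finset (Fin (m + d)) :=
  Finset.univ.map ((Function.Embedding.inr.trans Function.Embedding.inr).trans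
    E.toEquiv.toEmbedding : Fin q ↪ Fin (m + d))

/-- The list of the remaining points. -/
def word : List (Fin (m + d)) := List.ofFn fun s => E.toEquiv (Sum.inr (Sum.inr s))

theorem mem_pathPts (x : Fin (m + d)) :
    x ∈ E.pathPts ↔ ∃ y, E.toEquiv (Sum.inr (Sum.inl y)) = x := by
  simp [pathPts]

theorem mem_restPts (x : Fin (m + d)) :
    x ∈ E.restPts ↔ ∃ y, E.toEquiv (Sum.inr (Sum.inr y)) = x := by
  simp [restPts]

theorem card_pathPts : E.pathPts.card = α.ord := by
  rw [pathPts, Finset.card_map, Finset.card_univ, card_pts]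

theorem card_restPts : E.restPts.card = q := by
  rw [restPts, Finset.card_map, Finset.card_univ, Fintype.card_fin]

theorem word_mem_lists : E.word ∈ Multiset.lists E.restPts.val := by
  rw [Multiset.mem_lists_iff]
  change E.restPts.val = (E.word : Multiset (Fin (m + d)))
  refine (Multiset.Nodup.ext E.restPts.nodup ?_).2 fun x => ?_
  · rw [Multiset.coe_nodup, word, List.nodup_ofFn]
    intro s s' h
    exact Sum.inr_injective (Sum.inr_injective (E.toEquiv.injective h))
  · rw [Finset.mem_val, mem_restPts, Multiset.mem_coe, word, List.mem_ofFn]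

theorem pathPts_subset : E.pathPts ⊆ tailPts m (m + d) := by
  intro x hx
  obtain ⟨y, rfl⟩ := (E.mem_pathPts x).1 hx
  exact E.inr_mem_tailPts _

theorem restPts_subset : E.restPts ⊆ tailPts m (m + d) \ E.pathPts := by
  intro x hx
  obtain ⟨y, rfl⟩ := (E.mem_restPts x).1 hx
  refine Finset.mem_sdiff.2 ⟨E.inr_mem_tailPts _, fun h => ?_⟩
  obtain ⟨z, hz⟩ := (E.mem_pathPts _).1 h
  cases E.toEquiv.injective hz

theorem isPath_gam {i j : Fin m} {k : ℕ} (h : α.entry i j = some k) :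
    IsPath E.gam i j k fun t => E.toEquiv (node α q i j t) := by
  refine ⟨E.head j, ?_, fun t ht ht' => ?_, fun t ht => E.gam_node h ht⟩
  · change E.toEquiv (node α q i j (k + 1)) = _
    rw [node_last h]
    exact E.head i
  · obtain ⟨x, hx⟩ := exists_pts_eq (q := q) h ht ht'
    change E.toEquiv (node α q i j t) ∈ _
    rw [hx]
    exact E.inr_mem_tailPts _

/-- The first step of the path is an edge of the model leaving `j`, so column `j` of `α` has a
nonzero entry. The model path of that entry has the same start, and paths are determined by their
start. -/
theorem eq_of_isPath {i j : Fin m} {k : ℕ} {p : ℕ → Fin (m + d)} (hp : IsPath E.gam i j k p) :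
    α.entry i j = some k ∧ ∀ t ≤ k + 1, p t = E.toEquiv (node α q i j t) := by
  obtain ⟨i', k', h⟩ : ∃ i' k', α.entry i' j = some k' := by
    have h1 := hp.2.2.2 0 (Nat.zero_le k)
    rw [hp.1, ← E.head, ← E.toEquiv.apply_symm_apply (p (0 + 1)), E.gam_eq_some] at h1
    rcases h1 with ⟨i', j', k', h, t, ht, e, -⟩ | ⟨s, e, -⟩
    · cases t with
      | zero =>
        obtain rfl := Sum.inl.inj e
        exact ⟨i', k', h⟩
      | succ t =>
        rw [node_succ_of_lt (by simpa [h] using ht)] at e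
        cases e
    · cases e
  obtain ⟨rfl, rfl, hpt⟩ := hp.eq (E.isPath_gam h)
  exact ⟨h, hpt⟩

theorem gam_mem_gamSet : E.gam ∈ gamSet α E.pathPts := by
  refine mem_gamSet.2 ⟨fun x hx => ?_, fun i j k => ?_, fun x => ?_, fun x hx hxP => ?_⟩
  · obtain ⟨a, rfl⟩ := E.toEquiv.surjective x
    rcases a with j | a | s
    · exact absurd (E.head j ▸ hx) (castAdd_notMem_tailPts j)
    · obtain ⟨i, j, k, t, h, ht, e⟩ := exists_node_eq (q := q) a
      rw [← e]
      exact ⟨⟨_, E.gam_node h ht⟩, ⟨_, E.gam_node h ht.le⟩⟩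
    · exact ⟨⟨_, E.gam_rest s⟩, ⟨_, E.gam_rest s⟩⟩
  · exact ⟨fun h => ⟨_, E.isPath_gam h⟩, fun ⟨p, hp⟩ => (E.eq_of_isPath hp).1⟩
  · rw [mem_pathPts]
    constructor
    · rintro ⟨a, rfl⟩
      obtain ⟨i, j, k, t, h, ht, e⟩ := exists_node_eq (q := q) a
      exact ⟨i, j, k, _, E.isPath_gam h, t + 1, by omega, ht, by rw [e]⟩
    · rintro ⟨i, j, k, p, hp, t, ht, ht', rfl⟩
      obtain ⟨h, hpt⟩ := E.eq_of_isPath hp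
      obtain ⟨x, hx⟩ := exists_pts_eq (q := q) h ht ht'
      exact ⟨x, by rw [hpt t (by omega), hx]⟩
  · obtain ⟨a, rfl⟩ := E.toEquiv.surjective x
    rcases a with j | a | s
    · exact absurd (E.head j ▸ hx) (castAdd_notMem_tailPts j)
    · exact absurd ((E.mem_pathPts _).2 ⟨a, rfl⟩) hxP
    · exact E.gam_rest s

theorem nonempty (α : GamZ m) (h : α.ord + q = d) : Nonempty (Labelling α q d) := by
  have hc : Fintype.card (Pts α ⊕ Fin q) = Fintype.card (Fin d) := by
    rw [Fintype.card_sum, card_pts, Fintype.card_fin, Fintype.card_fin, h]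
  exact ⟨⟨((Equiv.refl (Fin m)).sumCongr (Fintype.equivOfCardEq hc)).trans finSumFinEquiv,
    fun j => by simp⟩⟩

end Labelling

/-! ### Recovering a labelling from its partial bijection and word. -/

theorem exists_paths {m d : ℕ} {α : GamZ m} {σ : Gam (m + d)}
    (h : ∀ i j k, α.entry i j = some k → ∃ p, IsPath σ i j k p) :
    ∃ p : Fin m → Fin m → ℕ → Fin (m + d),
      ∀ i j k, α.entry i j = some k → IsPath σ i j k (p i j) := by
  have : ∀ i j, ∃ p : ℕ → Fin (m + d), ∀ k, α.entry i j = some k → IsPath σ i j k p := by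
    intro i j
    cases hij : α.entry i j with
    | none => exact ⟨fun _ => Fin.castAdd d j, fun k hk => by cases hk⟩
    | some k =>
      obtain ⟨p, hp⟩ := h i j k hij
      exact ⟨p, fun k' hk' => Option.some.inj hk' ▸ hp⟩
  choose p hp using this
  exact ⟨p, hp⟩

theorem pts_path_injective {m d : ℕ} {α : GamZ m} {σ : Gam (m + d)}
    {p : Fin m → Fin m → ℕ → Fin (m + d)}
    (hp : ∀ i j k, α.entry i j = some k → IsPath σ i j k (p i j)) :
    Function.Injective fun x : Pts α => p x.1.1 x.1.2 (x.2.val + 1) := by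
  intro x x' e
  obtain ⟨k, h, ht⟩ := exists_entry x
  obtain ⟨k', h', ht'⟩ := exists_entry x'
  obtain ⟨⟨i, j⟩, t⟩ := x
  obtain ⟨⟨i', j'⟩, t'⟩ := x'
  dsimp only at h h' ht ht'
  obtain ⟨htt, rfl⟩ := (hp i j k h).index_eq (hp i' j' k' h') _ _ ht ht' e
  obtain rfl := α.col_unique i i' j (by simp [h]) (by simp [h'])
  congr
  exact Fin.ext (by simpa using htt)

theorem card_eq_ord {m d : ℕ} {α : GamZ m} {σ : Gam (m + d)} {P : Finset (Fin (m + d))}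
    (h : ∀ i j k, α.entry i j = some k ↔ ∃ p, IsPath σ i j k p)
    (hP : ∀ x, x ∈ P ↔ ∃ i j k p, IsPath σ i j k p ∧ ∃ t, 1 ≤ t ∧ t ≤ k ∧ p t = x) :
    P.card = α.ord := by
  obtain ⟨p, hp⟩ := exists_paths fun i j k => (h i j k).1
  have : P = Finset.univ.map ⟨_, pts_path_injective hp⟩ := by
    ext x
    rw [hP]
    simp only [Finset.mem_map, Finset.mem_univ, true_and, Function.Embedding.coeFn_mk]
    constructor
    · rintro ⟨i, j, k, r, hr, t, ht, ht', rfl⟩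
      have hk := (h i j k).2 ⟨r, hr⟩
      refine ⟨⟨(i, j), ⟨t - 1, by simp only [hk, Option.getD_some]; omega⟩⟩, ?_⟩
      rw [(hr.eq (hp i j k hk)).2.2 t (by omega)]
      congr 1
      exact Nat.sub_add_cancel ht
    · rintro ⟨x, rfl⟩
      obtain ⟨k, hk, ht⟩ := exists_entry x
      exact ⟨_, _, k, _, hp _ _ k hk, x.2.val + 1, by omega, ht, rfl⟩
  rw [this, Finset.card_map, Finset.card_univ, card_pts]

/-- The data occurring in `Δ_n^{α,𝓜}` with `n - m = ord α + |𝓜|` come from labellings. -/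
theorem exists_labelling {m q d : ℕ} {α : GamZ m} (hd : α.ord + q = d)
    {P Q : Finset (Fin (m + d))} (hQ : Q ⊆ tailPts m (m + d) \ P) (hq : Q.card = q)
    {σ : Gam (m + d)} (hσ : σ ∈ gamSet α P) {w : List (Fin (m + d))}
    (hw : w ∈ Multiset.lists Q.val) : ∃ E : Labelling α q d, E.gam = σ ∧ E.word = w := by
  obtain ⟨hfull, hent, hP, hfix⟩ := mem_gamSet.1 hσ
  obtain ⟨hwn, hwQ, hwl⟩ := mem_lists_val hw
  rw [hq] at hwl
  obtain ⟨p, hp⟩ := exists_paths fun i j k => (hent i j k).1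
  have hpt : ∀ x : Pts α, p x.1.1 x.1.2 (x.2.val + 1) ∈ P ∧
      p x.1.1 x.1.2 (x.2.val + 1) ∈ tailPts m (m + d) := by
    intro x
    obtain ⟨k, hk, ht⟩ := exists_entry x
    exact ⟨(hP _).2 ⟨_, _, k, _, hp _ _ k hk, x.2.val + 1, by omega, ht, rfl⟩,
      (hp _ _ k hk).2.2.1 _ (by omega) ht⟩
  -- The labelling sends each model point to the corresponding point of a path of `σ` or letter of
  -- `w`. It is injective, and `ord α + q = d` makes it bijective.
  let F : Model α q → Fin (m + d) := Sum.elim (Fin.castAdd d)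
    (Sum.elim (fun x => p x.1.1 x.1.2 (x.2.val + 1)) fun s : Fin q => w.get (s.cast hwl.symm))
  have hwQ' : ∀ s : Fin q, w.get (s.cast hwl.symm) ∈ Q := fun s => (hwQ _).1 (List.get_mem _ _)
  have hF : Function.Injective F := by
    refine Function.Injective.sumElim (Fin.castAdd_injective m d)
      (Function.Injective.sumElim (pts_path_injective hp) ?_ ?_) ?_
    · intro s s' h
      exact Fin.cast_injective _ (hwn.injective_get h)
    · intro x s h
      exact (Finset.mem_sdiff.1 (hQ (hwQ' s))).2 (h ▸ (hpt x).1)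
    · rintro j (x | s) h
      · exact castAdd_notMem_tailPts j (Eq.mpr (congrArg (· ∈ _) h) (hpt x).2)
      · exact castAdd_notMem_tailPts j
          (Eq.mpr (congrArg (· ∈ _) h) (Finset.mem_sdiff.1 (hQ (hwQ' s))).1)
  have hcard : Fintype.card (Model α q) = Fintype.card (Fin (m + d)) := by
    rw [Fintype.card_sum, Fintype.card_sum, card_pts, Fintype.card_fin, Fintype.card_fin,
      Fintype.card_fin, hd]
  let E : Labelling α q d :=
    ⟨Equiv.ofBijective F ((Fintype.bijective_iff_injective_and_card F).2 ⟨hF, hcard⟩),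
      fun j => rfl⟩
  have hnode : ∀ i j k, α.entry i j = some k → ∀ t ≤ k + 1,
      E.toEquiv (node α q i j t) = p i j t := by
    intro i j k hij t ht
    have hpath := hp i j k hij
    cases t with
    | zero => exact hpath.1.symm
    | succ t =>
      rcases ht.lt_or_eq with ht | ht
      · rw [node_succ_of_lt (by simpa [hij] using ht)]
        rfl
      · obtain rfl : t = k := by omega
        rw [node_last hij]
        exact hpath.2.1.symm
  have hrel : ∀ a b, ModelRel a b → σ (E.toEquiv a) = some (E.toEquiv b) := by
    rintro _ _ (⟨i, j, k, hij, t, ht, rfl, rfl⟩ | ⟨s, rfl, rfl⟩)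
    · rw [hnode i j k hij t (by omega), hnode i j k hij (t + 1) (by omega)]
      exact (hp i j k hij).2.2.2 t ht
    · have := Finset.mem_sdiff.1 (hQ (hwQ' s))
      exact hfix _ this.1 this.2
  -- By `hrel` the model graph is contained in that of `σ`. For equality it is enough that every
  -- point in the domain of `σ` has an outgoing model edge.
  have hdom : ∀ a y, σ (E.toEquiv a) = some y → ∃ b, ModelRel a b := by
    rintro (j | x | s) y hy
    · obtain ⟨i, k, r, hr⟩ := exists_isPath hfull ((E.head j) ▸ hy)
      exact ⟨_, Or.inl ⟨i, j, k, (hent i j k).2 ⟨r, hr⟩, 0, Nat.zero_le k, rfl, rfl⟩⟩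
    · obtain ⟨i, j, k, t, h, ht, e⟩ := exists_node_eq (q := q) x
      exact ⟨_, Or.inl ⟨i, j, k, h, t + 1, ht, e.symm, rfl⟩⟩
    · exact ⟨_, Or.inr ⟨s, rfl, rfl⟩⟩
  refine ⟨E, gam_ext fun x y => ?_, ?_⟩
  · obtain ⟨a, rfl⟩ := E.toEquiv.surjective x
    obtain ⟨b, rfl⟩ := E.toEquiv.surjective y
    rw [E.gam_eq_some]
    refine ⟨hrel a b, fun h => ?_⟩
    obtain ⟨b', hb'⟩ := hdom a _ h
    have := hrel a b' hb'
    rw [h, Option.some.injEq, E.toEquiv.injective.eq_iff] at this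
    rwa [this]
  · refine List.ext_get (by rw [Labelling.word, List.length_ofFn, hwl]) fun n h1 h2 => ?_
    simp only [Labelling.word, List.get_eq_getElem, List.getElem_ofFn]
    rfl

/-! Full partial bijections and their types. -/

/-- `γ` is one of the products `σ c` occurring in `Δ_n^{α,𝓜}`. -/
def Occurs {m d : ℕ} (α : GamZ m) (μ : Ptn) (γ : Gam (m + d)) : Prop :=
  ∃ P ∈ (tailPts m (m + d)).powersetCard α.ord,
    ∃ Q ∈ (tailPts m (m + d) \ P).powersetCard μ.size, ∃ σ ∈ gamSet α P,
      ∃ w ∈ Multiset.lists Q.val, σ * ofPerm (cycles μ w) = γ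

-- At a full `γ` the factors `ε` can be omitted, so the coefficient counts the ways of writing `γ`
-- as `σ c`. Being a natural number, it admits no cancellation.
open Classical in
theorem coeffL_deltaN {m d : ℕ} (α : GamZ m) (μ : Ptn) {γ : Gam (m + d)} (hγ : Full m γ) :
    coeffL γ (deltaN α μ d) = ((∑ P ∈ (tailPts m (m + d)).powersetCard α.ord,
      ∑ Q ∈ (tailPts m (m + d) \ P).powersetCard μ.size, ∑ σ ∈ gamSet α P,
        ((Multiset.lists Q.val).map fun w =>
          if σ * ofPerm (cycles μ w) = γ then 1 else 0).sum : ℕ) : ℂ) := by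
  rw [deltaN_eq, map_sum, Nat.cast_sum]
  refine Finset.sum_congr rfl fun P hP => ?_
  rw [map_sum, Nat.cast_sum]
  refine Finset.sum_congr rfl fun Q hQ => ?_
  rw [deltaTerm, map_sum, Nat.cast_sum]
  refine Finset.sum_congr rfl fun σ _ => ?_
  rw [Finset.mem_powersetCard] at hP hQ
  rw [coeffL_mul_epsProd hγ hP.1, coeffL_mul_epsProd hγ (hQ.1.trans Finset.sdiff_subset), mul_assoc,
    coeffL_epsProd_mul hγ hP.1, cycSum_eq, ← Multiset.sum_map_mul_left, map_multiset_sum,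
    Nat.cast_multiset_sum, Multiset.map_map, Multiset.map_map]
  refine congrArg _ (Multiset.map_congr rfl fun w _ => ?_)
  simp only [Function.comp_apply]
  rw [← el_mul, coeffL_el]
  split_ifs <;> simp

theorem coeffL_deltaN_ne_zero {m d : ℕ} {α : GamZ m} {μ : Ptn} {γ : Gam (m + d)}
    (hγ : Full m γ) : coeffL γ (deltaN α μ d) ≠ 0 ↔ Occurs α μ γ := by
  classical
  rw [coeffL_deltaN α μ hγ, Nat.cast_ne_zero, Occurs]
  simp only [ne_eq, Finset.sum_eq_zero_iff, Multiset.sum_eq_zero_iff, Multiset.mem_map]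
  constructor
  · intro h
    push Not at h
    obtain ⟨P, hP, Q, hQ, σ, hσ, _, ⟨w, hw, rfl⟩, hne⟩ := h
    refine ⟨P, hP, Q, hQ, σ, hσ, w, hw, ?_⟩
    by_contra hc
    exact hne (if_neg hc)
  · rintro ⟨P, hP, Q, hQ, σ, hσ, w, hw, e⟩ h
    have := h P hP Q hQ σ hσ _ ⟨w, hw, rfl⟩
    rw [if_pos e] at this
    exact one_ne_zero this

theorem Full.mul_ofPerm {m n : ℕ} {σ : Gam n} (hσ : Full m σ) {c : Equiv.Perm (Fin n)}
    (hc : ∀ x ∉ tailPts m n, c x = x) : Full m (σ * ofPerm c) := by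
  intro x hx
  simp only [mul_eq_some, ofPerm_eq_some]
  constructor
  · have hcx : c x ∈ tailPts m n := by
      by_contra hn
      have := c.injective (hc _ hn)
      rw [this] at hn
      exact hn hx
    obtain ⟨y, hy⟩ := (hσ _ hcx).1
    exact ⟨y, c x, rfl, hy⟩
  · obtain ⟨y, hy⟩ := (hσ _ hx).2
    exact ⟨c.symm y, y, c.apply_symm_apply y, hy⟩

namespace Labelling

variable {m d : ℕ} {α : GamZ m} {μ : Ptn}

/-- The element of `Γ(n)` defined by a labelling. -/
noncomputable def prod (E : Labelling α μ.size d) : Gam (m + d) :=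
  E.gam * ofPerm (cycles μ E.word)

theorem occurs_prod (E : Labelling α μ.size d) : Occurs α μ E.prod :=
  ⟨E.pathPts, Finset.mem_powersetCard.2 ⟨E.pathPts_subset, E.card_pathPts⟩, E.restPts,
    Finset.mem_powersetCard.2 ⟨E.restPts_subset, E.card_restPts⟩, E.gam, E.gam_mem_gamSet,
    E.word, E.word_mem_lists, rfl⟩

theorem full_prod (E : Labelling α μ.size d) : Full m E.prod := by
  refine Full.mul_ofPerm (mem_gamSet.1 E.gam_mem_gamSet).1 fun x hx => ?_
  refine cycles_apply_of_notMem μ fun h => hx ?_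
  rw [(mem_lists_val E.word_mem_lists).2.1] at h
  exact (Finset.mem_sdiff.1 (E.restPts_subset h)).1

/-- Passing from one labelling to the other is a permutation of the points that fixes the first `m`
of them and carries the data of `E` to those of `E'`. Thus each type is a single conjugacy class. -/
theorem exists_conj (E E' : Labelling α μ.size d) : ∃ π : Equiv.Perm (Fin (m + d)),
    (∀ x, x.val < m → π x = x) ∧ ofPerm π * E.prod = E'.prod * ofPerm π := by
  let π : Equiv.Perm (Fin (m + d)) := E.toEquiv.symm.trans E'.toEquiv
  have hπ : ∀ a, π (E.toEquiv a) = E'.toEquiv a := fun a => by simp [π]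
  have hgam : ofPerm π * E.gam = E'.gam * ofPerm π := gam_ext fun x y => by
    obtain ⟨a, rfl⟩ := E.toEquiv.surjective x
    obtain ⟨b, rfl⟩ := E'.toEquiv.surjective y
    simp only [mul_eq_some, ofPerm_eq_some, hπ, exists_eq_left', E'.gam_eq_some]
    constructor
    · rintro ⟨z, hz, e⟩
      obtain ⟨c, rfl⟩ := E.toEquiv.surjective z
      rw [hπ, E'.toEquiv.injective.eq_iff] at e
      subst e
      exact (E.gam_eq_some _ _).1 hz
    · intro h
      exact ⟨_, (E.gam_eq_some _ _).2 h, hπ b⟩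
  have hword : E'.word = E.word.map π.toEmbedding := by
    rw [word, word, List.map_ofFn]
    congr 1
    funext s
    exact (hπ _).symm
  refine ⟨π, fun x hx => ?_, ?_⟩
  · have : x = Fin.castAdd d ⟨x.val, hx⟩ := rfl
    rw [this, ← E.head, hπ, E.head, E'.head]
  · have hcyc : π * cycles μ E.word = cycles μ E'.word * π := Equiv.ext fun x => by
      rw [hword]
      exact (cycles_map π.toEmbedding μ E.word x).symm
    unfold prod
    rw [← mul_assoc, hgam, mul_assoc, mul_assoc, ← ofPerm_mul, hcyc, ofPerm_mul]

end Labelling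

theorem Occurs.exists_labelling {m d : ℕ} {α : GamZ m} {μ : Ptn} {γ : Gam (m + d)}
    (h : Occurs α μ γ) (hd : α.ord + μ.size = d) : ∃ E : Labelling α μ.size d, E.prod = γ := by
  obtain ⟨P, hP, Q, hQ, σ, hσ, w, hw, rfl⟩ := h
  rw [Finset.mem_powersetCard] at hQ
  obtain ⟨E, rfl, rfl⟩ := PartialBij.exists_labelling hd hQ.1 hQ.2 hσ hw
  exact ⟨E, rfl⟩

/-- A path starts outside `Q` and can never enter it, since the `σ`-preimage of a point of `Q` lies
in `Q`. So it sees only points where `σ` and `τ` agree. -/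
theorem IsPath.of_agree {m d : ℕ} {σ τ : Gam (m + d)} {Q : Finset (Fin (m + d))}
    (hQ : Q ⊆ tailPts m (m + d)) (hσ : ∀ x ∈ Q, ∃ y ∈ Q, σ y = some x)
    (h : ∀ x ∉ Q, σ x = τ x) {i j : Fin m} {k : ℕ} {p : ℕ → Fin (m + d)}
    (hp : IsPath σ i j k p) : IsPath τ i j k p := by
  have key : ∀ t ≤ k, p t ∉ Q := by
    intro t
    induction t with
    | zero =>
      intro _ hc
      rw [hp.1] at hc
      exact castAdd_notMem_tailPts j (hQ hc)
    | succ t ih =>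
      intro ht hc
      obtain ⟨y, hy, e⟩ := hσ _ hc
      rw [gam_inj σ e (hp.2.2.2 t (by omega))] at hy
      exact ih (by omega) hy
  exact ⟨hp.1, hp.2.1, hp.2.2.1, fun t ht => h _ (key t ht) ▸ hp.2.2.2 t ht⟩

theorem perm_symm_mem {n : ℕ} {Q : Finset (Fin n)} {c : Equiv.Perm (Fin n)}
    (hc : ∀ x ∉ Q, c x = x) {x : Fin n} (hx : x ∈ Q) : c.symm x ∈ Q := by
  by_contra hn
  have := hc _ hn
  rw [Equiv.apply_symm_apply] at this
  exact hn (this ▸ hx)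

theorem isPath_mul_ofPerm {m d : ℕ} {σ : Gam (m + d)} {Q : Finset (Fin (m + d))}
    (hQ : Q ⊆ tailPts m (m + d)) (hσ : ∀ x ∈ Q, σ x = some x) {c : Equiv.Perm (Fin (m + d))}
    (hc : ∀ x ∉ Q, c x = x) {i j : Fin m} {k : ℕ} {p : ℕ → Fin (m + d)} :
    IsPath (σ * ofPerm c) i j k p ↔ IsPath σ i j k p := by
  have h : ∀ x ∉ Q, (σ * ofPerm c) x = σ x := fun x hx => Option.ext fun y => by
    simp only [mul_eq_some, ofPerm_eq_some, hc x hx, exists_eq_left']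
  refine ⟨IsPath.of_agree hQ (fun x hx => ⟨c.symm x, perm_symm_mem hc hx, ?_⟩) h,
    IsPath.of_agree hQ (fun x hx => ⟨x, hx, hσ x hx⟩) fun x hx => (h x hx).symm⟩
  exact (mul_eq_some _ _ _ _).2 ⟨x, (ofPerm_eq_some _ _ _).2 (c.apply_symm_apply x), hσ x hx⟩

theorem gamZ_ext {m : ℕ} {α β : GamZ m} (h : ∀ i j k, α.entry i j = some k ↔ β.entry i j = some k) :
    α = β := by
  obtain ⟨e, _, _⟩ := α
  obtain ⟨f, _, _⟩ := β
  obtain rfl : e = f := funext fun i => funext fun j => Option.ext (h i j)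
  rfl

/-- The paths of `γ = σ c` are those of `σ`, so `γ` determines `α` and `P`. As the sizes add up to
`d`, `Q` is the rest of the tail, where `γ` acts as `c`. The cycle type of `c` together with the
size gives `μ`. -/
theorem Occurs.unique {m d : ℕ} {α α' : GamZ m} {μ μ' : Ptn} {γ : Gam (m + d)}
    (h : Occurs α μ γ) (h' : Occurs α' μ' γ) (hd : α.ord + μ.size = d)
    (hd' : α'.ord + μ'.size = d) : α = α' ∧ μ = μ' := by
  obtain ⟨P, hP, Q, hQ, σ, hσ, w, hw, rfl⟩ := h
  obtain ⟨P', hP', Q', hQ', σ', hσ', w', hw', e⟩ := h'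
  have compl : ∀ {P Q : Finset (Fin (m + d))} {k l : ℕ}, k + l = d →
      P ∈ (tailPts m (m + d)).powersetCard k → Q ∈ (tailPts m (m + d) \ P).powersetCard l →
      Q = tailPts m (m + d) \ P := by
    intro P Q k l hkl hP hQ
    rw [Finset.mem_powersetCard] at hP hQ
    refine Finset.eq_of_subset_of_card_le hQ.1 ?_
    rw [Finset.card_sdiff_of_subset hP.1, card_tailPts]
    omega
  have paths : ∀ {α : GamZ m} {μ : Ptn} {P Q : Finset (Fin (m + d))} {σ : Gam (m + d)}
      {w : List (Fin (m + d))}, Q = tailPts m (m + d) \ P → σ ∈ gamSet α P →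
      w ∈ Multiset.lists Q.val →
      (∀ i j k, α.entry i j = some k ↔ ∃ p, IsPath (σ * ofPerm (cycles μ w)) i j k p) ∧
      (∀ x, x ∈ P ↔ ∃ i j k p, IsPath (σ * ofPerm (cycles μ w)) i j k p ∧
        ∃ t, 1 ≤ t ∧ t ≤ k ∧ p t = x) ∧
      ∀ x ∈ Q, (σ * ofPerm (cycles μ w)) x = some (cycles μ w x) := by
    intro α μ P Q σ w hQ hσ hw
    obtain ⟨-, h1, h2, h3⟩ := mem_gamSet.1 hσ
    have hc : ∀ x ∉ Q, cycles μ w x = x := fun x hx =>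
      cycles_apply_of_notMem μ (by rwa [(mem_lists_val hw).2.1])
    have hfix : ∀ x ∈ Q, σ x = some x := fun x hx => by
      rw [hQ, Finset.mem_sdiff] at hx
      exact h3 x hx.1 hx.2
    have key : ∀ i j k p, IsPath (σ * ofPerm (cycles μ w)) i j k p ↔ IsPath σ i j k p :=
      fun _ _ _ _ => isPath_mul_ofPerm (hQ ▸ Finset.sdiff_subset) hfix hc
    simp only [key]
    refine ⟨h1, h2, fun x hx => (mul_eq_some _ _ _ _).2 ⟨_, (ofPerm_eq_some _ _ _).2 rfl, ?_⟩⟩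
    refine hfix _ ?_
    by_contra hn
    rw [(cycles μ w).injective (hc _ hn)] at hn
    exact hn hx
  have hQe := compl hd hP hQ
  have hQe' := compl hd' hP' hQ'
  obtain ⟨h1, h2, h3⟩ := paths (μ := μ) hQe hσ hw
  obtain ⟨h1', h2', h3'⟩ := paths (μ := μ') hQe' hσ' hw'
  rw [e] at h1' h2' h3'
  obtain rfl : α = α' := gamZ_ext fun i j k => (h1 i j k).trans (h1' i j k).symm
  obtain rfl : P = P' := Finset.ext fun x => (h2 x).trans (h2' x).symm
  obtain rfl : Q = Q' := hQe.trans hQe'.symm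
  have hcyc : cycles μ w = cycles μ' w' := by
    refine Equiv.ext fun x => ?_
    by_cases hx : x ∈ Q
    · have := h3' x hx
      rw [h3 x hx] at this
      exact Option.some.inj this
    · rw [cycles_apply_of_notMem μ (by rwa [(mem_lists_val hw).2.1]),
        cycles_apply_of_notMem μ' (by rwa [(mem_lists_val hw').2.1])]
  refine ⟨rfl, Ptn.eq_of_filter (by omega) ?_⟩
  rw [Finset.mem_powersetCard] at hQ hQ'
  rw [← cycleType_cycles μ (mem_lists_val hw).1 (by rw [(mem_lists_val hw).2.2, hQ.2]),
    ← cycleType_cycles μ' (mem_lists_val hw').1 (by rw [(mem_lists_val hw').2.2, hQ'.2]), hcyc]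

theorem exists_gamZ {m d : ℕ} (γ : Gam (m + d)) :
    ∃ α : GamZ m, ∀ i j k, α.entry i j = some k ↔ ∃ p, IsPath γ i j k p := by
  classical
  let e : Matrix (Fin m) (Fin m) (Option ℕ) := fun i j =>
    if h : ∃ k p, IsPath γ i j k p then some h.choose else none
  have he : ∀ i j k, e i j = some k ↔ ∃ p, IsPath γ i j k p := by
    intro i j k
    by_cases h : ∃ k p, IsPath γ i j k p
    · have : e i j = some h.choose := dif_pos h
      rw [this, Option.some.injEq]
      constructor
      · rintro rfl
        exact h.choose_spec
      · rintro ⟨p, hp⟩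
        obtain ⟨p', hp'⟩ := h.choose_spec
        exact (hp'.eq hp).2.1
    · have : e i j = none := dif_neg h
      rw [this]
      constructor
      · rintro ⟨⟩
      · exact fun h' => absurd ⟨k, h'⟩ h
  have he' : ∀ i j, e i j ≠ none → ∃ k p, IsPath γ i j k p := by
    intro i j h
    obtain ⟨k, hk⟩ := Option.ne_none_iff_exists'.1 h
    exact ⟨k, (he i j k).1 hk⟩
  refine ⟨⟨e, fun i j j' h h' => ?_, fun i i' j h h' => ?_⟩, he⟩
  -- Rows: two paths with the same end become, when reversed, two paths of the inverse with the same
  -- start.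
  · obtain ⟨k, p, hp⟩ := he' _ _ h
    obtain ⟨k', p', hp'⟩ := he' _ _ h'
    exact (hp.reverse.eq hp'.reverse).1
  · obtain ⟨k, p, hp⟩ := he' _ _ h
    obtain ⟨k', p', hp'⟩ := he' _ _ h'
    exact (hp.eq hp').1

/-- Every point preceding one of the first `m` points lies on a path. -/
theorem exists_isPath_last {m d : ℕ} {γ : Gam (m + d)} (hγ : Full m γ) {i : Fin m}
    {y : Fin (m + d)} (hy : γ y = some (Fin.castAdd d i)) :
    ∃ j k p, IsPath γ i j k p ∧ p k = y := by
  obtain ⟨j, k, p, hp⟩ := exists_isPath hγ.symm ((symm_eq_some γ _ _).2 hy)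
  have h1 := hp.2.2.2 0 (Nat.zero_le k)
  rw [hp.1, symm_eq_some] at h1
  have h2 := hp.reverse
  rw [PEquiv.symm_symm] at h2
  refine ⟨j, k, _, h2, ?_⟩
  rw [Nat.add_sub_cancel_left]
  exact gam_inj γ h1 hy

/-- Let `P` be the set of intermediate points of paths and `Q` the rest of the tail. A point of `Q`
cannot be sent to a head point or into `P`, since it would then lie on a path. So `γ` induces a
permutation `c` of `Q`, and `γ = (γ c⁻¹) c` with `γ c⁻¹` fixing `Q` and having the same paths. -/
theorem exists_occurs {m d : ℕ} {γ : Gam (m + d)} (hγ : Full m γ) :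
    ∃ (α : GamZ m) (μ : Ptn), α.ord + μ.size = d ∧ Occurs α μ γ := by
  classical
  obtain ⟨α, hα⟩ := exists_gamZ γ
  let P : Finset (Fin (m + d)) := Finset.univ.filter fun x =>
    ∃ i j k p, IsPath γ i j k p ∧ ∃ t, 1 ≤ t ∧ t ≤ k ∧ p t = x
  have hP : ∀ x, x ∈ P ↔ ∃ i j k p, IsPath γ i j k p ∧ ∃ t, 1 ≤ t ∧ t ≤ k ∧ p t = x := by
    simp [P]
  have hPt : P ⊆ tailPts m (m + d) := by
    intro x hx
    obtain ⟨i, j, k, p, hp, t, ht, ht', rfl⟩ := (hP x).1 hx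
    exact hp.2.2.1 t ht ht'
  have hPc := card_eq_ord hα hP
  set Q := tailPts m (m + d) \ P with hQdef
  have hQt : Q ⊆ tailPts m (m + d) := Finset.sdiff_subset
  have hQc : Q.card + α.ord = d := by
    rw [← hPc, hQdef, Finset.card_sdiff_add_card_eq_card hPt, card_tailPts]
  have hinv : ∀ x ∈ Q, ∃ y ∈ Q, γ x = some y := by
    intro x hx
    obtain ⟨hxt, hxP⟩ := Finset.mem_sdiff.1 hx
    obtain ⟨y, hy⟩ := (hγ x hxt).1
    refine ⟨y, Finset.mem_sdiff.2 ⟨?_, fun hyP => ?_⟩, hy⟩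
    · by_contra hc
      obtain ⟨i, rfl⟩ := exists_castAdd hc
      obtain ⟨j, k, p, hp, rfl⟩ := exists_isPath_last hγ hy
      rcases Nat.eq_zero_or_pos k with rfl | hk
      · rw [hp.1] at hxt
        exact castAdd_notMem_tailPts j hxt
      · exact hxP ((hP _).2 ⟨i, j, k, p, hp, k, hk, le_rfl, rfl⟩)
    · obtain ⟨i, j, k, p, hp, t, ht, ht', rfl⟩ := (hP y).1 hyP
      obtain ⟨t, rfl⟩ := Nat.exists_eq_add_of_le' ht
      obtain rfl := gam_inj γ hy (hp.2.2.2 t (by omega))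
      rcases Nat.eq_zero_or_pos t with rfl | hk
      · rw [hp.1] at hxt
        exact castAdd_notMem_tailPts j hxt
      · exact hxP ((hP _).2 ⟨i, j, k, p, hp, t, hk, by omega, rfl⟩)
  let g : Fin (m + d) → Fin (m + d) := fun x => if x ∈ Q then (γ x).getD x else x
  have hgQ : ∀ x ∈ Q, γ x = some (g x) ∧ g x ∈ Q := by
    intro x hx
    obtain ⟨y, hy, h⟩ := hinv x hx
    have : g x = y := by simp [g, hx, h]
    rw [this]
    exact ⟨h, hy⟩
  have hgn : ∀ x ∉ Q, g x = x := fun x hx => by simp [g, hx]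
  have hg : Function.Injective g := by
    intro x y hxy
    by_cases hx : x ∈ Q
    · by_cases hy : y ∈ Q
      · refine gam_inj γ (hgQ x hx).1 ?_
        rw [hxy]
        exact (hgQ y hy).1
      · exact absurd ((hgn y hy) ▸ hxy ▸ (hgQ x hx).2) hy
    · by_cases hy : y ∈ Q
      · exact absurd ((hgn x hx) ▸ hxy ▸ (hgQ y hy).2) hx
      · rwa [hgn x hx, hgn y hy] at hxy
  let c : Equiv.Perm (Fin (m + d)) := Equiv.ofBijective g (Finite.injective_iff_bijective.1 hg)
  have hcn : ∀ x ∉ Q, c x = x := hgn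
  have hcn' : ∀ x ∉ Q, c⁻¹ x = x := fun x hx => by
    rw [Equiv.Perm.inv_eq_iff_eq, hcn x hx]
  obtain ⟨μ, hμ, w, hw, hcw⟩ := exists_cycles_eq Q c hcn
  have hmul : γ * ofPerm c⁻¹ * ofPerm c = γ := by rw [mul_assoc, ofPerm_inv_mul, mul_one]
  have hσQ : ∀ x ∈ Q, (γ * ofPerm c⁻¹) x = some x := fun x hx => by
    refine (mul_eq_some _ _ _ _).2 ⟨c.symm x, (ofPerm_eq_some _ _ _).2 rfl, ?_⟩
    rw [(hgQ _ (perm_symm_mem hcn hx)).1]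
    exact congrArg some (c.apply_symm_apply x)
  have hpath : ∀ i j k p, IsPath (γ * ofPerm c⁻¹) i j k p ↔ IsPath γ i j k p := by
    intro i j k p
    conv_rhs => rw [← hmul]
    exact (isPath_mul_ofPerm hQt hσQ hcn).symm
  refine ⟨α, μ, by omega, P, Finset.mem_powersetCard.2 ⟨hPt, hPc⟩, Q,
    Finset.mem_powersetCard.2 ⟨le_rfl, hμ.symm⟩, γ * ofPerm c⁻¹, ?_, w, hw, by rw [hcw, hmul]⟩
  refine mem_gamSet.2 ⟨hγ.mul_ofPerm fun x hx => hcn' x fun h => hx (hQt h), ?_, ?_,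
    fun x hx hxP => hσQ x (Finset.mem_sdiff.2 ⟨hx, hxP⟩)⟩
  · simpa only [hpath] using hα
  · simpa only [hpath] using hP

/-! Spanning and linear independence. -/

/-- Under the `0`-embedding, `θ` is compression by the idempotent `e` of the last point. As `e`
commutes with `a`, `e a e = 0` gives `e a = 0`. Conjugation by the transposition of `x` and the last
point, with which `a` commutes, moves this to `x`. -/
theorem eps_mul_eq_zero_of_last {m d : ℕ} {a : Alg (m + (d + 1))} (ha : a ∈ centr m (m + (d + 1)))
    (h : theta (m + d) a = 0) {x : Fin (m + (d + 1))} (hx : x ∈ tailPts m (m + (d + 1))) :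
    el (eps x) * a = 0 := by
  set e : Alg (m + (d + 1)) := el (eps (Fin.last (m + d))) with he
  have hlast : e * a = 0 := by
    have h1 := extLin_theta (n := m + d) a
    rw [h, map_zero] at h1
    have h2 : e * a = a * e := eps_comm_centr (Nat.le_add_right m d) ha
    have h3 : e * e = e := by rw [he, ← el_mul, eps_mul_self]
    calc e * a = e * (e * a) := by rw [← mul_assoc, h3]
      _ = e * a * e := by rw [mul_assoc, ← h2]
      _ = 0 := h1.symm
  set π : Equiv.Perm (Fin (m + (d + 1))) := Equiv.swap x (Fin.last (m + d)) with hπ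
  have hπx : π (Fin.last (m + d)) = x := Equiv.swap_apply_right _ _
  have hfix : ∀ y : Fin (m + (d + 1)), y.val < m → π y = y := by
    intro y hy
    refine Equiv.swap_apply_of_ne_of_ne ?_ ?_
    · rintro rfl
      rw [mem_tailPts] at hx
      omega
    · rintro rfl
      simp at hy
  have hcomm := commute_ofPerm_of_mem_centr ha hfix
  have h4 : el (eps x) * a * el (ofPerm π) = 0 := by
    rw [mul_assoc, ← hcomm.eq, ← mul_assoc, ← el_mul]
    nth_rewrite 1 [← hπx]
    rw [eps_mul_ofPerm, el_mul, mul_assoc]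
    change el (ofPerm π) * (e * a) = 0
    rw [hlast, mul_zero]
  calc el (eps x) * a = el (eps x) * a * (el (ofPerm π) * el (ofPerm π⁻¹)) := by
        rw [← el_mul, ofPerm_mul_inv, el_one, mul_one]
    _ = 0 := by rw [← mul_assoc, h4, zero_mul]

theorem eps_mul_deltaN {m d : ℕ} {α : GamZ m} {μ : Ptn} (hd : α.ord + μ.size = d)
    {x : Fin (m + d)} (hx : x ∈ tailPts m (m + d)) : el (eps x) * deltaN α μ d = 0 := by
  refine deltaN_mem (LinearMap.ker (LinearMap.mulLeft ℂ (el (eps x))))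
    fun P Q hP hQ hPQ hPc hQc => eps_mul_deltaTerm α μ hx ?_
  have : P ∪ Q = tailPts m (m + d) := by
    refine Finset.eq_of_subset_of_card_le (Finset.union_subset hP hQ) ?_
    rw [card_tailPts, Finset.card_union_of_disjoint hPQ]
    omega
  rwa [this]

theorem deltaN_eq_zero {m d : ℕ} {α : GamZ m} {μ : Ptn} (hd : d < α.ord + μ.size) :
    deltaN α μ d = 0 := by
  have h : deltaN α μ d ∈ (⊥ : Submodule ℂ (Alg (m + d))) := by
    refine deltaN_mem _ fun P Q hP hQ hPQ hPc hQc => ?_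
    have := Finset.card_le_card (Finset.union_subset hP hQ)
    rw [card_tailPts, Finset.card_union_of_disjoint hPQ] at this
    omega
  exact h

theorem exists_type {m d : ℕ} {γ : Gam (m + d)} (hγ : Full m γ) :
    ∃ x : GamZ m × Ptn, x.1.ord + x.2.size = d ∧ coeffL γ (deltaN x.1 x.2 d) ≠ 0 := by
  obtain ⟨α, μ, hd, h⟩ := exists_occurs hγ
  exact ⟨(α, μ), hd, (coeffL_deltaN_ne_zero hγ).2 h⟩

theorem type_unique {m d : ℕ} {γ : Gam (m + d)} (hγ : Full m γ) {x y : GamZ m × Ptn}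
    (hx : x.1.ord + x.2.size = d) (hy : y.1.ord + y.2.size = d)
    (hx' : coeffL γ (deltaN x.1 x.2 d) ≠ 0) (hy' : coeffL γ (deltaN y.1 y.2 d) ≠ 0) : x = y := by
  rw [coeffL_deltaN_ne_zero hγ] at hx' hy'
  exact Prod.ext_iff.2 (hx'.unique hy' hx hy)

theorem exists_full {m d : ℕ} {x : GamZ m × Ptn} (hx : x.1.ord + x.2.size = d) :
    ∃ γ : Gam (m + d), Full m γ ∧ coeffL γ (deltaN x.1 x.2 d) ≠ 0 := by
  obtain ⟨E⟩ := Labelling.nonempty x.1 hx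
  exact ⟨E.prod, E.full_prod, (coeffL_deltaN_ne_zero E.full_prod).2 E.occurs_prod⟩

theorem coeffL_eq_of_type {m d : ℕ} {γ γ' : Gam (m + d)} (hγ : Full m γ) (hγ' : Full m γ')
    {x : GamZ m × Ptn} (hx : x.1.ord + x.2.size = d) (h : coeffL γ (deltaN x.1 x.2 d) ≠ 0)
    (h' : coeffL γ' (deltaN x.1 x.2 d) ≠ 0) {a : Alg (m + d)} (ha : a ∈ centr m (m + d)) :
    coeffL γ a = coeffL γ' a := by
  rw [coeffL_deltaN_ne_zero hγ] at h
  rw [coeffL_deltaN_ne_zero hγ'] at h'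
  obtain ⟨E, rfl⟩ := h.exists_labelling hx
  obtain ⟨E', rfl⟩ := h'.exists_labelling hx
  obtain ⟨π, hπ, e⟩ := E.exists_conj E'
  exact coeffL_conj π (commute_ofPerm_of_mem_centr ha hπ) e

/-- Choose a full representative `r x` of each type `x`, and let `b` be the combination of the `Δ`
with the same coefficients as `a` at the representatives. -/
theorem mem_span_deltaN {m d : ℕ} {a : Alg (m + d)} (ha : a ∈ centr m (m + d))
    (h : ∀ x ∈ tailPts m (m + d), el (eps x) * a = 0) :
    a ∈ Submodule.span ℂ ((fun x : GamZ m × Ptn => deltaN x.1 x.2 d) ''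
      {x | x.1.ord + x.2.size = d}) := by
  classical
  have hT : ∀ γ : Gam (m + d), ∃ x : GamZ m × Ptn, Full m γ →
      x.1.ord + x.2.size = d ∧ coeffL γ (deltaN x.1 x.2 d) ≠ 0 := by
    intro γ
    by_cases hγ : Full m γ
    · obtain ⟨x, hx⟩ := exists_type hγ
      exact ⟨x, fun _ => hx⟩
    · exact ⟨(⟨fun _ _ => none, by simp, by simp⟩, ⟨0, default⟩), fun h => absurd h hγ⟩
  choose T hT using hT
  have hr : ∀ x : GamZ m × Ptn, ∃ γ : Gam (m + d), x.1.ord + x.2.size = d →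
      Full m γ ∧ coeffL γ (deltaN x.1 x.2 d) ≠ 0 := by
    intro x
    by_cases hx : x.1.ord + x.2.size = d
    · obtain ⟨γ, hγ⟩ := exists_full hx
      exact ⟨γ, fun _ => hγ⟩
    · exact ⟨1, fun h => absurd h hx⟩
  choose r hr using hr
  set X := (Finset.univ.filter fun γ : Gam (m + d) => Full m γ).image T with hX
  have hXd : ∀ x ∈ X, x.1.ord + x.2.size = d := by
    intro x hx
    obtain ⟨γ, hγ, rfl⟩ := Finset.mem_image.1 hx
    exact (hT γ (Finset.mem_filter.1 hγ).2).1
  set b : Alg (m + d) := ∑ x ∈ X, (coeffL (r x) a / coeffL (r x) (deltaN x.1 x.2 d)) •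
    deltaN x.1 x.2 d with hb
  have hbc : b ∈ centr m (m + d) :=
    sum_mem fun x _ => Subalgebra.smul_mem _ (deltaN_mem_centr x.1 x.2 d) _
  have hbe : ∀ x ∈ tailPts m (m + d), el (eps x) * b = 0 := by
    intro x hx
    rw [hb, Finset.mul_sum]
    refine Finset.sum_eq_zero fun y hy => ?_
    rw [mul_smul_comm, eps_mul_deltaN (hXd y hy) hx, smul_zero]
  have hab : a - b = 0 := by
    have h1 : ∀ x ∈ tailPts m (m + d), el (eps x) * (a - b) = 0 := fun x hx => by
      rw [mul_sub, h x hx, hbe x hx, sub_zero]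
    -- At a full `γ` only the `Δ` of its own type `T γ` contributes to `b`, and both `a` and that
    -- `Δ` have the same coefficient at `γ` as at `r (T γ)`.
    refine eq_zero_of_full h1 (fun x hx => ?_) fun γ hγ => ?_
    · rw [← (commute_eps_of_mem_centr (sub_mem ha hbc) hx).eq, h1 x hx]
    · obtain ⟨hd, hne⟩ := hT γ hγ
      obtain ⟨hrf, hrn⟩ := hr (T γ) hd
      rw [map_sub, sub_eq_zero, hb, map_sum, Finset.sum_eq_single (T γ)]
      · rw [map_smul, smul_eq_mul, coeffL_eq_of_type hγ hrf hd hne hrn ha,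
          coeffL_eq_of_type hγ hrf hd hne hrn (deltaN_mem_centr _ _ d), div_mul_cancel₀ _ hrn]
      · intro x hx hxT
        rw [map_smul, smul_eq_mul]
        by_cases hc : coeffL γ (deltaN x.1 x.2 d) = 0
        · rw [hc, mul_zero]
        · exact absurd (type_unique hγ (hXd x hx) hd hc hne) hxT
      · intro hc
        exact absurd (Finset.mem_image_of_mem T
          (Finset.mem_filter.2 ⟨Finset.mem_univ γ, hγ⟩)) hc
  rw [sub_eq_zero.1 hab]
  exact Submodule.sum_mem _ fun x hx =>
    Submodule.smul_mem _ _ (Submodule.subset_span ⟨x, hXd x hx, rfl⟩)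

/-! ### Level-by-level approximation in the projective limit. -/

/-- The `d`-th term of an element of `A_m`. -/
noncomputable def term (m d : ℕ) : limAlg m →ₗ[ℂ] Alg (m + d) :=
  (LinearMap.proj d).comp (Subalgebra.toSubmodule (limAlg m)).subtype

theorem term_delta {m : ℕ} (x : GamZ m × Ptn) (d : ℕ) :
    term m d (delta x) = deltaN x.1 x.2 d := rfl

theorem limAlg_ext {m : ℕ} {a b : limAlg m} (h : ∀ d, term m d a = term m d b) : a = b :=
  Subtype.ext (funext h)

theorem term_mem_centr {m : ℕ} (a : limAlg m) (d : ℕ) : term m d a ∈ centr m (m + d) :=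
  a.2.1 d

theorem theta_term {m : ℕ} (a : limAlg m) (d : ℕ) :
    theta (m + d) (term m (d + 1) a) = term m d a :=
  a.2.2.1 d

theorem mem_limFilt {m N : ℕ} {a : limAlg m} :
    a ∈ limFilt m N ↔ ∀ d, term m d a ∈ filt m (m + d) N := Iff.rfl

theorem eps_mul_term_eq_zero {m d : ℕ} {a : limAlg m} (h : ∀ e < d, term m e a = 0)
    {x : Fin (m + d)} (hx : x ∈ tailPts m (m + d)) : el (eps x) * term m d a = 0 := by
  cases d with
  | zero =>
    rw [Finset.card_eq_zero.1 (card_tailPts m 0)] at hx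
    exact absurd hx (Finset.notMem_empty x)
  | succ d =>
    refine eps_mul_eq_zero_of_last (term_mem_centr a (d + 1)) ?_ hx
    rw [theta_term, h d (Nat.lt_succ_self d)]

/-- The correction at level `d` uses only `Δ` of size `d`, whose terms at lower levels are zero, so
agreement at those levels is preserved. -/
theorem exists_span_term_eq {m d : ℕ} {a : limAlg m} (h : ∀ e < d, term m e a = 0) :
    ∃ b ∈ Submodule.span ℂ (delta '' {x : GamZ m × Ptn | x.1.ord + x.2.size = d}),
      ∀ e ≤ d, term m e b = term m e a := by
  have h1 := mem_span_deltaN (term_mem_centr a d) fun x hx => eps_mul_term_eq_zero h hx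
  have h2 : (fun x : GamZ m × Ptn => deltaN x.1 x.2 d) '' {x | x.1.ord + x.2.size = d} =
      term m d '' (delta '' {x : GamZ m × Ptn | x.1.ord + x.2.size = d}) := by
    rw [Set.image_image]
    rfl
  rw [h2, Submodule.span_image] at h1
  obtain ⟨b, hb, hba⟩ := h1
  refine ⟨b, hb, fun e he => ?_⟩
  rcases he.lt_or_eq with he | rfl
  · rw [h e he]
    have : Submodule.span ℂ (delta '' {x : GamZ m × Ptn | x.1.ord + x.2.size = d}) ≤
        LinearMap.ker (term m e) := by
      rw [Submodule.span_le]
      rintro _ ⟨x, hx, rfl⟩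
      exact deltaN_eq_zero (hx ▸ he)
    exact this hb
  · exact hba

/-- Correct the terms with `d = 0, …, N` successively. The remainder still has `m`-degree at most
`N`, and its first nonzero term would be annihilated by all tail `ε_x` at a level `d > N`, which is
impossible. -/
theorem limFilt_le_span (m N : ℕ) :
    limFilt m N ≤ Submodule.span ℂ (delta '' {x : GamZ m × Ptn | x.1.ord + x.2.size ≤ N}) := by
  intro a ha
  have key : ∀ t ≤ N + 1, ∃ b ∈ Submodule.span ℂ
      (delta '' {x : GamZ m × Ptn | x.1.ord + x.2.size ≤ N}),
      ∀ e < t, term m e (a - b) = 0 := by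
    intro t
    induction t with
    | zero => exact fun _ => ⟨0, zero_mem _, fun e he => absurd he (Nat.not_lt_zero e)⟩
    | succ t ih =>
      intro ht
      obtain ⟨b, hb, h⟩ := ih (by omega)
      obtain ⟨c, hc, hc'⟩ := exists_span_term_eq h
      refine ⟨b + c, add_mem hb (Submodule.span_mono (Set.image_mono fun x hx => ?_) hc),
        fun e he => ?_⟩
      · change _ ≤ N
        rw [hx]
        omega
      · rw [← sub_sub, map_sub, hc' e (by omega), sub_self]
  obtain ⟨b, hb, h⟩ := key (N + 1) le_rfl
  have hbN : b ∈ limFilt m N := by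
    refine Submodule.span_le.2 ?_ hb
    rintro _ ⟨x, hx, rfl⟩
    exact delta_mem_limFilt hx
  have hzero : a - b = 0 := by
    refine limAlg_ext fun d => ?_
    rw [map_zero]
    induction d using Nat.strong_induction_on with
    | _ d ih =>
      rcases lt_or_ge N d with hd | hd
      · exact eq_zero_of_mem_filt (fun x hx => eps_mul_term_eq_zero ih hx)
          (mem_limFilt.1 (sub_mem ha hbN) d) hd
      · exact h d (by omega)
  rwa [sub_eq_zero.1 hzero]

theorem span_delta (m : ℕ) : ⊤ ≤ Submodule.span ℂ (Set.range (delta (m := m))) := by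
  intro a _
  obtain ⟨N, hN⟩ := a.2.2.2
  have ha : a ∈ limFilt m N := fun d => filt_zero_le_filt m (m + d) N (hN d)
  exact Submodule.span_mono (Set.image_subset_range _ _) (limFilt_le_span m N ha)

/-- Take `x` of minimal size `d` in a supposed relation and a full `γ` of type `x` at level `d`. At
that level the `Δ` of larger size are zero, and the others of size `d` have coefficient zero at `γ`.
-/
theorem linearIndependent_delta (m : ℕ) : LinearIndependent ℂ (delta (m := m)) := by
  rw [linearIndependent_iff]
  intro l hl
  by_contra hne
  obtain ⟨x, hx, hmin⟩ := Finset.exists_min_image l.support (fun x => x.1.ord + x.2.size)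
    (Finsupp.support_nonempty_iff.2 hne)
  obtain ⟨γ, hγ, hγx⟩ := exists_full (x := x) rfl
  have h := congrArg (fun a => coeffL γ (term m _ a)) hl
  simp only [map_zero] at h
  rw [Finsupp.linearCombination_apply, Finsupp.sum, map_sum, map_sum,
    Finset.sum_eq_single x] at h
  · rw [map_smul, map_smul, smul_eq_mul, term_delta] at h
    exact (mul_ne_zero (Finsupp.mem_support_iff.1 hx) hγx) h
  · intro y hy hyx
    rw [map_smul, map_smul, term_delta, smul_eq_mul]
    refine mul_eq_zero_of_right _ ?_
    rcases (hmin y hy).lt_or_eq with hlt | heq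
    · rw [deltaN_eq_zero hlt, map_zero]
    · by_contra hc
      exact hyx (type_unique hγ heq.symm rfl hc hγx)
  · exact fun hc => absurd hx hc

end PartialBij

/-! ### The bases of `A_m` and of its filtration terms. -/

open PartialBij
theorem theorem5p15 (m : ℕ) :
    (∃ b : Module.Basis (GamZ m × Ptn) ℂ (limAlg m),
      ∀ (α : GamZ m) (μ : Ptn), (b (α, μ) : ∀ d : ℕ, Alg (m + d)) = deltaN α μ) ∧
    ∀ N : ℕ, ∃ b : Module.Basis {x : GamZ m × Ptn // x.1.ord + x.2.size ≤ N} ℂ (limFilt m N),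
      ∀ x, ((b x : limAlg m) : ∀ d : ℕ, Alg (m + d)) = deltaN x.1.1 x.1.2 := by
  refine ⟨⟨Module.Basis.mk (linearIndependent_delta m) (span_delta m), fun α μ => ?_⟩,
    fun N => ?_⟩
  · rw [Module.Basis.mk_apply]
    rfl
  · let v : {x : GamZ m × Ptn // x.1.ord + x.2.size ≤ N} → limFilt m N :=
      fun x => ⟨delta x.1, delta_mem_limFilt x.2⟩
    have hv : LinearIndependent ℂ v :=
      LinearIndependent.of_comp (limFilt m N).subtype
        ((linearIndependent_delta m).comp _ Subtype.val_injective)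
    have hspan : ⊤ ≤ Submodule.span ℂ (Set.range v) := by
      rintro a -
      have h1 := limFilt_le_span m N a.2
      have h2 : delta '' {x : GamZ m × Ptn | x.1.ord + x.2.size ≤ N} =
          (limFilt m N).subtype '' Set.range v := by
        rw [← Set.range_comp, Set.image_eq_range]
        rfl
      rw [h2, Submodule.span_image] at h1
      obtain ⟨a', ha', e⟩ := h1
      rwa [← Subtype.ext e]
    refine ⟨Module.Basis.mk hv hspan, fun x => ?_⟩
    rw [Module.Basis.mk_apply]
    rfl
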